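/- Let $k\ge 6$ and $g=2d\ge 6$, and let $G$ be a finite $k$-regular graph of girth $g$ and excess $4$, that is, of order $n=2\left(1+(k-1)+\dots+(k-1)^{d-1}\right)+4$. Let $A$ be the adjacency matrix of $G$. Let $E$ be the excess matrix of $G$: its rows and columns are indexed by the vertices, and its entry at $(u,v)$ is $1$ if the distance of $u$ and $v$ in $G$ is $d+1$, and $0$ otherwise. Let $H_0(x)=1$, $H_1(x)=x$ and $H_{m+1}(x)=xH_m(x)-(k-1)H_{m-1}(x)$ for $m\ge1$ (the Dickson polynomials of the second kind with parameter $k-1$). Then $G$ is bipartite, and: 1) $E$ is the adjacency matrix of the graph $G(E)$ on the vertices of $G$ in which two vertices are adjacent if and only if their distance in $G$ is $d+1$, and $G(E)$ is a disjoint union of $c$ cycles $C_1,\dots,C_c$, of lengths $l_1,\dots,l_c\ge 3$. If $d$ is odd and $V_1,V_2$ are the partition sets of the bipartite graph $G$, then each cycle $C_i$ is completely contained in $V_1$ or in $V_2$. 2) The spectrum of $A$ (the eigenvalues listed with multiplicity) consists of 2.1) if $d$ is odd: $k$ and $-k$, $c-2$ (not necessarily distinct) solutions of $H_{d-1}(x)=-2$,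 and one solution of each equation $H_{d-1}(x)=-2\cos\left(\frac{2\pi j}{l_i}\right)$, $1\le j\le l_i-1$, $1\le i\le c$; 2.2) if $d$ is even: $k$ and $-k$, $c-1$ (not necessarily distinct) solutions of $H_{d-1}(x)=-2$, and one solution of each equation $H_{d-1}(x)=-2\cos\left(\frac{2\pi j}{l_i}\right)$, $1\le j\le l_i-1$, $1\le i\le c$, except for one pair $(i,j)$, for which $2j=l_i$ (so that the omitted equation is $H_{d-1}(x)=2$). In particular, the number of eigenvalues of $A$, counted with multiplicity, that satisfy $H_{d-1}(x)=-2$ is exactly $c-2$ if $d$ is odd and $c-1$ if $d$ is even. -/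

import Mathlib

namespace BipartiteExcess

/-- A `(k,g)`-graph: a `k`-regular graph of girth `g`. -/
structure IsKGGraph {V : Type*} [Fintype V] (G : SimpleGraph V) [DecidableRel G.Adj]
    (k g : ℕ) : Prop where
  regular : G.IsRegularOfDegree k
  girth_eq : G.egirth = (g : ℕ∞)

/-- The Moore bound `M(k,g)`, for `k ≥ 2` and `g ≥ 3`. -/
def mooreBound (k g : ℕ) : ℕ :=
  if Odd g then 1 + ∑ i ∈ Finset.range ((g - 3) / 2 + 1), k * (k - 1) ^ i
  else 2 * ∑ i ∈ Finset.range ((g - 2) / 2 + 1), (k - 1) ^ i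

/-- The excess `n - M(k,g)` of a `(k,g)`-graph of order `n`, as an integer. -/
def excess (V : Type*) [Fintype V] (k g : ℕ) : ℤ :=
  (Fintype.card V : ℤ) - (mooreBound k g : ℤ)

/-- The excess matrix `E = A_{d+1}`: the entry at `(u,v)` is `1` if the distance of `u` and `v` in
`G` is `d + 1`, and `0` otherwise. -/
noncomputable def excessMatrix {V : Type*} (G : SimpleGraph V) (d : ℕ) : Matrix V V ℝ :=
  Matrix.of fun u v => if G.dist u v = d + 1 then 1 else 0

/-- The excess graph `G(E)`: two vertices are adjacent if and only if their distance in `G` is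
`d + 1`. -/
def excessGraph {V : Type*} (G : SimpleGraph V) (d : ℕ) : SimpleGraph V where
  Adj u v := G.dist u v = d + 1
  symm := ⟨fun u v h => by rw [SimpleGraph.dist_comm]; exact h⟩
  loopless := ⟨fun u h => by simp at h⟩

noncomputable instance {V : Type*} (G : SimpleGraph V) (d : ℕ) : DecidableRel (excessGraph G d).Adj :=
  fun u v => inferInstanceAs (Decidable (G.dist u v = d + 1))

/-- The disjoint union of `c` cycles, the `i`-th one having length `l i` (for `l i ≥ 3`). -/
def cycleUnion {c : ℕ} (l : Fin c → ℕ) : SimpleGraph (Σ i : Fin c, Fin (l i)) where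
  Adj p q := ∃ (i : Fin c) (x y : Fin (l i)),
    p = ⟨i, x⟩ ∧ q = ⟨i, y⟩ ∧ (SimpleGraph.cycleGraph (l i)).Adj x y
  symm := ⟨fun _ _ ⟨i, x, y, hp, hq, h⟩ => ⟨i, y, x, hq, hp, h.symm⟩⟩
  loopless := ⟨fun p ⟨i, x, y, hp, hq, h⟩ => by
    subst hp
    simp only [Sigma.mk.injEq, heq_eq_eq, true_and] at hq
    exact h.ne hq⟩

/-- The polynomial `H_m` for valency `k`: the Dickson polynomial of the second kind with parameter
`k - 1` and degree `m`, so `H_0 = 1`, `H_1 = x` and `H_{m+2} = x H_{m+1} - (k-1) H_m`. -/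
noncomputable def H (k m : ℕ) : Polynomial ℝ :=
  Polynomial.dickson 2 ((k : ℝ) - 1) m

/-- The spectrum of a matrix: its eigenvalues, listed with their multiplicities. -/
noncomputable def spectrumOf {V : Type*} [Fintype V] [DecidableEq V] (A : Matrix V V ℝ) :
    Multiset ℝ :=
  A.charpoly.roots

/-- The pairs `(i, j)` with `1 ≤ i ≤ c` and `1 ≤ j ≤ l i - 1` (the cycles being numbered by
`Fin c`). -/
def cycleIndices {c : ℕ} (l : Fin c → ℕ) : Finset (Σ _ : Fin c, ℕ) :=
  Finset.univ.sigma fun i => Finset.Icc 1 (l i - 1)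

end BipartiteExcess

/-! ### Short walks in a graph of girth at least 2d. -/

namespace BipartiteExcess
open SimpleGraph

section Walks
variable {V : Type*} {G : SimpleGraph V} {u v w x y : V} {d m : ℕ}

/-! Below half the girth, walks behave as in a forest. Hence for m < d the matrix H_m(A) is the 0/1
matrix of pairs joined by a walk of length m (`aeval_H_apply`). Its row sums for m = d-1 are half
the Moore bound, and for an edge uv the two rows have disjoint supports, so exactly four vertices
lie at distance at least d from both u and v (`card_far`).

Bipartiteness means that no edge joins two vertices equidistant from some u. At distance below d
this is the girth condition; at distance d and beyond it is a counting argument. A vertex w at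
distance d has `geodesicNeighbors` on the side of u and `outerNeighbors` on its own side, k in all.
The former pack into the k neighbours of u, while the latter lie among four far vertices and share
little, as there are no triangles or 4-cycles. For k ≥ 6 these bounds are incompatible with a bad
edge (`not_adj_of_dist_eq`, `not_adj_of_lt_dist`).

With the diameter at most d+1 and a ±1 vector s for the bipartition, E = (J ± s sᵀ)/2 - H_{d-1}(A)
(`excessMatrix_eq`). Row sums give 2-regularity, hence cycles. Both rank-one terms are along
eigenvectors of A, so Brauer's theorem relates the spectrum of E to the values -H_{d-1} on that of
A, only the images of k and -k being moved, to 2 and 2(-1)^(d-1) (`exists_spectrum`). Comparing with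
the spectrum of a union of cycles, where each cycle contributes one 2 and the numbers 2cos(2πj/l_i),
gives the result. -/

lemma isAcyclic_fromEdgeSet (s : Finset (Sym2 V)) (hs : (s : Set (Sym2 V)) ⊆ G.edgeSet)
    (hcard : (s.card : ℕ∞) < G.egirth) : (fromEdgeSet (s : Set (Sym2 V))).IsAcyclic := by
  classical
  intro a w hw
  have hle : fromEdgeSet (s : Set (Sym2 V)) ≤ G := by
    intro x y hxy
    exact hs ((fromEdgeSet_adj _).1 hxy).1
  have h1 := egirth_le_length (hw.mapLe hle)
  have h2 : w.length ≤ s.card := by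
    rw [← Walk.length_edges, ← List.toFinset_card_of_nodup hw.edges_nodup]
    apply Finset.card_le_card
    intro e he
    have := w.edges_subset_edgeSet (List.mem_toFinset.1 he)
    rw [edgeSet_fromEdgeSet] at this
    exact_mod_cast this.1
  rw [Walk.length_map] at h1
  exact absurd (hcard.trans_le h1) (by exact_mod_cast h2.not_gt)

/-- A cycle needs at least as many edges as the girth, so the edges of two short walks span a
forest. Parity of lengths and uniqueness of paths then come from forests. -/
lemma exists_isAcyclic_of_walks (p q : G.Walk u v) (h : ((p.length + q.length : ℕ) : ℕ∞) < G.egirth) :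
    ∃ T : SimpleGraph V, T.IsAcyclic ∧ (∀ e ∈ p.edges, e ∈ T.edgeSet) ∧
      ∀ e ∈ q.edges, e ∈ T.edgeSet := by
  classical
  have hp := p.edges_subset_edgeSet
  have hq := q.edges_subset_edgeSet
  refine ⟨fromEdgeSet ((p.edges.toFinset ∪ q.edges.toFinset : Finset _) : Set (Sym2 V)),
    isAcyclic_fromEdgeSet (G := G) _ ?_ ?_, ?_, ?_⟩
  · intro e he
    simp only [Finset.coe_union, List.coe_toFinset, Set.mem_union, Set.mem_ofPred_eq] at he
    exact he.elim (fun h => hp h) (fun h => hq h)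
  · refine lt_of_le_of_lt ?_ h
    have h1 := List.toFinset_card_le p.edges
    have h2 := List.toFinset_card_le q.edges
    have h3 := Finset.card_union_le p.edges.toFinset q.edges.toFinset
    rw [Walk.length_edges] at h1 h2
    exact_mod_cast h3.trans (by omega)
  · intro e he
    rw [edgeSet_fromEdgeSet]
    exact ⟨by simp [he], G.not_isDiag_of_mem_edgeSet (hp he)⟩
  · intro e he
    rw [edgeSet_fromEdgeSet]
    exact ⟨by simp [he], G.not_isDiag_of_mem_edgeSet (hq he)⟩

lemma even_length_iff_of_lt_egirth (p q : G.Walk u v)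
    (h : ((p.length + q.length : ℕ) : ℕ∞) < G.egirth) : Even p.length ↔ Even q.length := by
  obtain ⟨T, hT, hp, hq⟩ := exists_isAcyclic_of_walks p q h
  have c : T.Coloring Bool := hT.colorable_two.toColoring (by simp)
  have h1 := c.even_length_iff_congr (p.transfer T hp)
  have h2 := c.even_length_iff_congr (q.transfer T hq)
  rw [Walk.length_transfer] at h1 h2
  rw [h1, h2]

lemma isPath_eq_of_lt_egirth {p q : G.Walk u v} (hp : p.IsPath) (hq : q.IsPath)
    (h : ((p.length + q.length : ℕ) : ℕ∞) < G.egirth) : p = q := by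
  obtain ⟨T, hT, hp', hq'⟩ := exists_isAcyclic_of_walks p q h
  have := (hT.subsingleton_path u v).elim ⟨_, hp.transfer hp'⟩ ⟨_, hq.transfer hq'⟩
  have h2 := congrArg (fun r : T.Path u v => (r : T.Walk u v).support) this
  simp only [Walk.support_transfer] at h2
  exact Walk.ext_support h2

/-- There is a walk of length exactly `m` between the two vertices. -/
def HasWalk (G : SimpleGraph V) (m : ℕ) (u v : V) : Prop := ∃ p : G.Walk u v, p.length = m

lemma hasWalk_zero : HasWalk G 0 u v ↔ u = v :=
  ⟨fun ⟨_, hp⟩ => Walk.eq_of_length_eq_zero hp, fun h => h ▸ ⟨Walk.nil, rfl⟩⟩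

lemma hasWalk_one : HasWalk G 1 u v ↔ G.Adj u v :=
  ⟨fun ⟨_, hp⟩ => Walk.adj_of_length_eq_one hp, fun h => ⟨h.toWalk, by simp⟩⟩

lemma HasWalk.symm (h : HasWalk G m u v) : HasWalk G m v u := by
  obtain ⟨p, hp⟩ := h
  exact ⟨p.reverse, by simpa⟩

lemma HasWalk.dist_le (h : HasWalk G m u v) : G.dist u v ≤ m := by
  obtain ⟨p, rfl⟩ := h
  exact SimpleGraph.dist_le p

lemma HasWalk.concat (h : HasWalk G m u v) (hvw : G.Adj v w) : HasWalk G (m + 1) u w := by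
  obtain ⟨p, hp⟩ := h
  exact ⟨p.concat hvw, by simpa⟩

lemma hasWalk_succ : HasWalk G (m + 1) u v ↔ ∃ x, G.Adj x v ∧ HasWalk G m u x := by
  constructor
  · rintro ⟨p, hp⟩
    have hn : ¬ p.Nil := by
      intro h
      rw [← Walk.length_eq_zero_iff] at h
      omega
    refine ⟨p.penultimate, p.adj_penultimate hn, p.dropLast, ?_⟩
    simp [hp]
  · rintro ⟨x, hx, h⟩
    exact h.concat hx

lemma HasWalk.add_two (h : HasWalk G m u v) (hv : ∃ x, G.Adj v x) : HasWalk G (m + 2) u v := by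
  obtain ⟨x, hx⟩ := hv
  exact (h.concat hx).concat hx.symm

lemma HasWalk.add_even (h : HasWalk G m u v) (hv : ∃ x, G.Adj v x) {n : ℕ} (hmn : m ≤ n)
    (hpar : Even m ↔ Even n) : HasWalk G n u v := by
  obtain ⟨j, rfl⟩ : ∃ j, n = m + 2 * j := by
    rcases Nat.even_or_odd m with hm | hm
    · obtain ⟨a, ha⟩ := hm; obtain ⟨b, hb⟩ := hpar.1 ⟨a, ha⟩
      exact ⟨b - a, by omega⟩
    · have := fun hn => Nat.not_even_iff_odd.2 hm (hpar.2 hn)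
      obtain ⟨a, ha⟩ := hm; obtain ⟨b, hb⟩ := Nat.not_even_iff_odd.1 this
      exact ⟨b - a, by omega⟩
  clear hpar hmn
  induction j with
  | zero => exact h
  | succ j ih => exact ih.add_two hv

lemma HasWalk.even_iff (hg : ((2 * d : ℕ) : ℕ∞) ≤ G.egirth) {a b : ℕ} (h : HasWalk G a u v)
    (h' : HasWalk G b u v) (hab : a + b < 2 * d) : Even a ↔ Even b := by
  obtain ⟨p, rfl⟩ := h
  obtain ⟨q, rfl⟩ := h'
  exact even_length_iff_of_lt_egirth p q (lt_of_lt_of_le (by exact_mod_cast hab) hg)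

/-- Up to half the girth, a walk that is not a path can be shortened by two. -/
lemma hasWalk_sub_two_of_not_isPath (hg : ((2 * d : ℕ) : ℕ∞) ≤ G.egirth)
    (hv : ∃ x, G.Adj v x) (p : G.Walk u v) (hp : p.length = m + 2) (hm : m + 2 < d + 1)
    (hnp : ¬ p.IsPath) : HasWalk G m u v := by
  classical
  have hlt : p.bypass.length < p.length := by
    refine lt_of_le_of_ne p.length_bypass_le_length fun h => hnp ?_
    rw [← p.bypass_eq_self_of_length_le_length_bypass h.ge]
    exact p.bypass_isPath
  have hb : HasWalk G p.bypass.length u v := ⟨_, rfl⟩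
  have he := hb.even_iff hg ⟨p, rfl⟩ (by omega)
  refine hb.add_even hv ?_ ?_
  · by_contra hc
    have : p.length = p.bypass.length + 1 := by omega
    rw [this, Nat.even_add_one] at he
    tauto
  · rw [he, hp]
    simp [parity_simps]

/-- Without a walk of length m to v, the extensions through x and y are both paths; their total
length 2(m+2) is below the girth, so they coincide and have the same penultimate vertex. -/
lemma eq_of_hasWalk_of_adj (hg : ((2 * d : ℕ) : ℕ∞) ≤ G.egirth) (hm : m + 2 < d)
    (hno : ¬ HasWalk G m u v) (hx : G.Adj x v) (hy : G.Adj y v) (hux : HasWalk G (m + 1) u x)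
    (huy : HasWalk G (m + 1) u y) : x = y := by
  obtain ⟨p, hp⟩ := hux
  obtain ⟨q, hq⟩ := huy
  have key : ∀ {z : V} (hz : G.Adj z v) (r : G.Walk u z), r.length = m + 1 →
      (r.concat hz).IsPath := by
    intro z hz r hr
    by_contra hc
    exact hno (hasWalk_sub_two_of_not_isPath hg ⟨z, hz.symm⟩ _ (by simp [hr]) (by omega) hc)
  have := isPath_eq_of_lt_egirth (key hx p hp) (key hy q hq)
    (lt_of_lt_of_le (by simp only [Walk.length_concat, hp, hq]; exact_mod_cast (by omega)) hg)
  simpa using congrArg Walk.penultimate this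

end Walks
end BipartiteExcess

/-! ### The matrices H_m(A) and the four vertices far from an edge. -/

namespace BipartiteExcess
open SimpleGraph

set_option linter.unusedSectionVars false

lemma H_zero (k : ℕ) : H k 0 = 1 := by
  simp only [H, Polynomial.dickson_zero]; norm_num

lemma H_one (k : ℕ) : H k 1 = Polynomial.X := by simp [H]

lemma H_add_two (k m : ℕ) :
    H k (m + 2) = Polynomial.X * H k (m + 1) - Polynomial.C ((k : ℝ) - 1) * H k m := by
  simp only [H, Polynomial.dickson_add_two]

lemma eval_H_valency (k m : ℕ) :
    (H k m).eval (k : ℝ) = ∑ i ∈ Finset.range (m + 1), ((k : ℝ) - 1) ^ i := by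
  induction m using Nat.twoStepInduction with
  | zero => simp [H_zero]
  | one => simp [H_one, Finset.sum_range_succ]
  | more m h1 h2 =>
    rw [H_add_two, Polynomial.eval_sub, Polynomial.eval_mul, Polynomial.eval_mul,
      Polynomial.eval_X, Polynomial.eval_C, h1, h2, Finset.sum_range_succ _ (m + 2),
      Finset.sum_range_succ _ (m + 1)]
    ring

lemma eval_H_neg (k m : ℕ) (x : ℝ) : (H k m).eval (-x) = (-1) ^ m * (H k m).eval x := by
  induction m using Nat.twoStepInduction with
  | zero => simp [H_zero]
  | one => simp [H_one]
  | more m h1 h2 =>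
    rw [H_add_two]
    simp only [Polynomial.eval_sub, Polynomial.eval_mul, Polynomial.eval_X, Polynomial.eval_C,
      h1, h2]
    ring

lemma aeval_mulVec_of_mulVec_eq_smul {n : Type*} [Fintype n] [DecidableEq n] {A : Matrix n n ℝ}
    {x : n → ℝ} {t : ℝ} (h : A.mulVec x = t • x) (p : Polynomial ℝ) :
    (Polynomial.aeval A p).mulVec x = p.eval t • x := by
  induction p using Polynomial.induction_on with
  | C a => simp [Matrix.algebraMap_eq_diagonal, Matrix.mulVec_diagonal, funext_iff]
  | add p q hp hq => simp [Matrix.add_mulVec, hp, hq, add_smul]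
  | monomial m a ih =>
    rw [pow_succ, ← mul_assoc, map_mul, Polynomial.aeval_X, ← Matrix.mulVec_mulVec, h,
      Matrix.mulVec_smul, ih, smul_smul, Polynomial.eval_mul_X, mul_comm]

section Counting
variable {V : Type*} [Fintype V] [DecidableEq V] {G : SimpleGraph V} [DecidableRel G.Adj]
  {k d : ℕ}

lemma exists_adj_of_regular (hreg : G.IsRegularOfDegree k) (hk : 0 < k) (v : V) :
    ∃ x, G.Adj v x := by
  rw [← G.degree_pos_iff_exists_adj v, hreg v]
  exact hk

open Classical in
/-- Below half the girth, `H_m(A)` records the pairs joined by a walk of length `m`. -/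
lemma aeval_H_apply (hreg : G.IsRegularOfDegree k) (hk : 0 < k)
    (hg : ((2 * d : ℕ) : ℕ∞) ≤ G.egirth) {m : ℕ} (hm : m < d) (u v : V) :
    Polynomial.aeval (G.adjMatrix ℝ) (H k m) u v = if HasWalk G m u v then 1 else 0 := by
  induction m using Nat.twoStepInduction generalizing v with
  | zero => simp [H_zero, hasWalk_zero, Matrix.one_apply]
  | one => simp [H_one, hasWalk_one]
  | more m h1 h2 =>
    have hv := exists_adj_of_regular hreg hk v
    rw [H_add_two, mul_comm Polynomial.X, map_sub, map_mul, map_mul, Polynomial.aeval_X,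
      Polynomial.aeval_C, Matrix.sub_apply, mul_adjMatrix_apply, Matrix.algebraMap_eq_diagonal,
      Matrix.diagonal_mul, h1 (by omega),
      Finset.sum_congr rfl (fun x _ => h2 (by omega) x), Finset.sum_boole]
    simp only [Pi.algebraMap_apply, Algebra.algebraMap_self_apply]
    -- The entry is the number of neighbours of v reached in m+1 steps, minus k-1 if v is reached in
    -- m. In that case all k neighbours count, leaving 1; otherwise at most one counts.
    by_cases hw : HasWalk G m u v
    · rw [if_pos hw, if_pos (hw.add_two hv), Finset.filter_true_of_mem, card_neighborFinset_eq_degree,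
        hreg v]
      · ring
      · intro x hx
        exact hw.concat ((mem_neighborFinset _ _ _).1 hx)
    · rw [if_neg hw, mul_zero, sub_zero]
      have huniq : ∀ x ∈ {x ∈ G.neighborFinset v | HasWalk G (m + 1) u x},
          ∀ y ∈ {x ∈ G.neighborFinset v | HasWalk G (m + 1) u x}, x = y := by
        intro x hx y hy
        rw [Finset.mem_filter, mem_neighborFinset] at hx hy
        exact eq_of_hasWalk_of_adj hg hm hw hx.1.symm hy.1.symm hx.2 hy.2
      split_ifs with h
      · obtain ⟨x, hxv, hx⟩ := hasWalk_succ.1 h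
        have : ({x ∈ G.neighborFinset v | HasWalk G (m + 1) u x}).card = 1 := by
          refine le_antisymm (Finset.card_le_one.2 huniq) (Finset.card_pos.2 ⟨x, ?_⟩)
          simp [hxv.symm, hx]
        exact_mod_cast this
      · rw [Nat.cast_eq_zero, Finset.card_eq_zero, Finset.filter_eq_empty_iff]
        intro x hx hw'
        exact h (hw'.concat ((mem_neighborFinset _ _ _).1 hx).symm)

lemma adjMatrix_mulVec_one (hreg : G.IsRegularOfDegree k) :
    (G.adjMatrix ℝ).mulVec (fun _ => 1) = (k : ℝ) • (fun _ => 1) := by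
  ext v
  simp [hreg v]

/-- A regular graph of order `M(k, 2d) + 4` and girth at least `2d`, in the range considered. -/
structure HasExcessFour (G : SimpleGraph V) [DecidableRel G.Adj] (k d : ℕ) : Prop where
  regular : G.IsRegularOfDegree k
  six_le : 6 ≤ k
  three_le : 3 ≤ d
  le_egirth : ((2 * d : ℕ) : ℕ∞) ≤ G.egirth
  card_eq : Fintype.card V = 2 * ∑ i ∈ Finset.range d, (k - 1) ^ i + 4

namespace HasExcessFour
variable (h : HasExcessFour G k d) {u v w x y : V}
include h

lemma exists_adj (v : V) : ∃ x, G.Adj v x :=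
  exists_adj_of_regular h.regular (by have := h.six_le; omega) v

lemma eval_H_eq : (H k (d - 1)).eval (k : ℝ) = ((∑ i ∈ Finset.range d, (k - 1) ^ i : ℕ) : ℝ) := by
  have h1 := h.six_le
  have h2 := h.three_le
  rw [eval_H_valency, show d - 1 + 1 = d by omega]
  push_cast [Nat.cast_sub (show 1 ≤ k by omega)]
  rfl

open Classical in
lemma card_hasWalk (u : V) :
    ({x | HasWalk G (d - 1) u x} : Finset V).card = ∑ i ∈ Finset.range d, (k - 1) ^ i := by
  have h1 := h.six_le
  have h2 := h.three_le
  have := congrFun (aeval_mulVec_of_mulVec_eq_smul (adjMatrix_mulVec_one h.regular) (H k (d - 1))) u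
  rw [h.eval_H_eq] at this
  simp only [Matrix.mulVec, dotProduct, Pi.smul_apply, smul_eq_mul, mul_one,
    aeval_H_apply h.regular (by omega) h.le_egirth (show d - 1 < d by omega)] at this
  rw [Finset.sum_boole] at this
  exact_mod_cast this

-- The vertices reached in d-1 steps from u and those from v are disjoint by parity, and each set
-- has half the Moore bound; the excess is what remains.
open Classical in
lemma card_not_hasWalk (huv : G.Adj u v) :
    ({x | ¬ HasWalk G (d - 1) u x ∧ ¬ HasWalk G (d - 1) v x} : Finset V).card = 4 := by
  have h2 := h.three_le
  have hdisj : Disjoint ({x | HasWalk G (d - 1) u x} : Finset V)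
      ({x | HasWalk G (d - 1) v x} : Finset V) := by
    rw [Finset.disjoint_left]
    intro x hx hy
    simp only [Finset.mem_filter, Finset.mem_univ, true_and] at hx hy
    have := (hy.symm.concat huv.symm).symm.even_iff h.le_egirth hx (by omega)
    rw [Nat.even_add_one] at this
    tauto
  have h3 := Finset.card_union_of_disjoint hdisj
  rw [h.card_hasWalk, h.card_hasWalk] at h3
  have h4 := Finset.card_add_card_compl (({x | HasWalk G (d - 1) u x} : Finset V) ∪
      ({x | HasWalk G (d - 1) v x} : Finset V))
  rw [h.card_eq, h3] at h4
  have h5 : ({x | ¬ HasWalk G (d - 1) u x ∧ ¬ HasWalk G (d - 1) v x} : Finset V) =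
    (({x | HasWalk G (d - 1) u x} : Finset V) ∪ ({x | HasWalk G (d - 1) v x} : Finset V))ᶜ := by
    ext x; simp
  rw [h5]
  omega

/-- An unreachable vertex would put its closed neighbourhood, of at least 7 vertices, among the four
missed by an edge. -/
lemma connected : G.Connected := by
  classical
  have hne : Nonempty V := by
    rw [← Fintype.card_pos_iff, h.card_eq]
    omega
  refine ⟨fun u w => ?_⟩
  by_contra hr
  obtain ⟨v, huv⟩ := h.exists_adj u
  have h1 := h.card_not_hasWalk huv
  have hsub : insert w (G.neighborFinset w) ⊆
      ({x | ¬ HasWalk G (d - 1) u x ∧ ¬ HasWalk G (d - 1) v x} : Finset V) := by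
    intro x hx
    have hwx : G.Reachable x w := by
      rcases Finset.mem_insert.1 hx with rfl | hx
      · rfl
      · exact ((mem_neighborFinset _ _ _).1 hx).reachable.symm
    simp only [Finset.mem_filter, Finset.mem_univ, true_and]
    exact ⟨fun ⟨p, _⟩ => hr (p.reachable.trans hwx),
      fun ⟨p, _⟩ => hr (huv.reachable.trans (p.reachable.trans hwx))⟩
  have h2 := Finset.card_le_card hsub
  rw [h1, Finset.card_insert_of_notMem (by simp), card_neighborFinset_eq_degree, h.regular w] at h2
  have := h.six_le
  omega

lemma hasWalk_dist (u v : V) : HasWalk G (G.dist u v) u v := h.connected.exists_walk_length_eq_dist u v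

lemma hasWalk_iff {m : ℕ} (hm : m < d) :
    HasWalk G m u v ↔ G.dist u v ≤ m ∧ (Even (G.dist u v) ↔ Even m) := by
  constructor
  · intro hw
    exact ⟨hw.dist_le, (h.hasWalk_dist u v).even_iff h.le_egirth hw (by have := hw.dist_le; omega)⟩
  · rintro ⟨h1, h2⟩
    exact (h.hasWalk_dist u v).add_even (h.exists_adj v) h1 h2

lemma dist_le_add_one (u : V) (hvw : G.Adj v w) : G.dist u w ≤ G.dist u v + 1 :=
  ((h.hasWalk_dist u v).concat hvw).dist_le

lemma dist_le_add_one' (hvw : G.Adj v w) (u : V) : G.dist w u ≤ G.dist v u + 1 := by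
  rw [dist_comm (u := w), dist_comm (u := v)]
  exact h.dist_le_add_one u hvw

lemma dist_ne_of_adj (hvw : G.Adj v w) (hd : G.dist u v < d) : G.dist u w ≠ G.dist u v := by
  intro he
  have h1 := h.hasWalk_dist u w
  rw [he] at h1
  have := h1.even_iff h.le_egirth ((h.hasWalk_dist u v).concat hvw) (by omega)
  rw [Nat.even_add_one] at this
  tauto

lemma not_adj_of_adj_adj (h1 : G.Adj u v) (h2 : G.Adj v w) : ¬ G.Adj u w := by
  intro h3
  have := (hasWalk_one.2 h3).even_iff h.le_egirth ((hasWalk_one.2 h1).concat h2)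
    (by have := h.three_le; omega)
  simp at this

lemma eq_of_common_neighbors (hxy : x ≠ y) (h1 : G.Adj x v) (h2 : G.Adj v y) (h3 : G.Adj x w)
    (h4 : G.Adj w y) : v = w := by
  have key : ∀ {z} (hz : G.Adj x z) (hz' : G.Adj z y), (hz'.toWalk.cons hz).IsPath := by
    intro z hz hz'
    simp [hz.ne, hz'.ne, hxy]
  have := isPath_eq_of_lt_egirth (key h1 h2) (key h3 h4)
    (lt_of_lt_of_le (by simp only [Walk.length_cons]; exact_mod_cast (by
      have := h.three_le; simp; omega)) h.le_egirth)
  simpa using congrArg Walk.snd this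

lemma card_far (huv : G.Adj u v) :
    ({x | d ≤ G.dist u x ∧ d ≤ G.dist v x} : Finset V).card = 4 := by
  classical
  have hd := h.three_le
  rw [← h.card_not_hasWalk huv]
  congr 1
  ext x
  simp only [Finset.mem_filter, Finset.mem_univ, true_and]
  -- If x is closer to a than d, either parity gives a walk of length d-1 from a, or there is one of
  -- length d-2, which the edge ab extends to one of length d-1 from b.
  have key : ∀ {a b : V}, G.Adj a b → ¬ HasWalk G (d - 1) a x → ¬ HasWalk G (d - 1) b x →
      d ≤ G.dist a x := by
    intro a b hab ha hb
    by_contra hc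
    by_cases hp : Even (G.dist a x) ↔ Even (d - 1)
    · exact ha ((h.hasWalk_iff (by omega)).2 ⟨by omega, hp⟩)
    · have h1 : G.dist a x ≠ d - 1 := fun he => hp (by rw [he])
      have h2 : HasWalk G (d - 2) a x := by
        refine (h.hasWalk_iff (by omega)).2 ⟨by omega, ?_⟩
        rw [show d - 1 = d - 2 + 1 by omega, Nat.even_add_one] at hp
        tauto
      have := (h2.symm.concat hab).symm
      rw [show d - 2 + 1 = d - 1 by omega] at this
      exact hb this
  constructor
  · rintro ⟨h1, h2⟩
    exact ⟨fun hw => by have := hw.dist_le; omega, fun hw => by have := hw.dist_le; omega⟩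
  · rintro ⟨h1, h2⟩
    exact ⟨key huv h1 h2, key huv.symm h2 h1⟩

/-- Geodesics of length `d` from `u` to `w` may be counted at either end. -/
lemma card_geodesic_ends (huw : G.dist u w = d) :
    ({v ∈ G.neighborFinset u | G.dist v w = d - 1}).card =
      ({x ∈ G.neighborFinset w | G.dist u x = d - 1}).card := by
  classical
  have hd := h.three_le
  have hk := h.six_le
  -- The two counts are the (u, w) entries of A·H_{d-1}(A) and H_{d-1}(A)·A.
  have hcomm : Polynomial.aeval (G.adjMatrix ℝ) (H k (d - 1)) * G.adjMatrix ℝ =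
      G.adjMatrix ℝ * Polynomial.aeval (G.adjMatrix ℝ) (H k (d - 1)) := by
    calc _ = Polynomial.aeval (G.adjMatrix ℝ) (H k (d - 1) * Polynomial.X) := by simp
      _ = Polynomial.aeval (G.adjMatrix ℝ) (Polynomial.X * H k (d - 1)) := by rw [mul_comm]
      _ = _ := by simp
  have := congrFun (congrFun hcomm u) w
  rw [mul_adjMatrix_apply, adjMatrix_mul_apply] at this
  simp only [aeval_H_apply h.regular (by omega) h.le_egirth (show d - 1 < d by omega)] at this
  rw [Finset.sum_boole, Finset.sum_boole] at this
  have h1 : {v ∈ G.neighborFinset u | HasWalk G (d - 1) v w} =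
      {v ∈ G.neighborFinset u | G.dist v w = d - 1} := by
    refine Finset.filter_congr fun v hv => ?_
    have := h.dist_le_add_one' ((mem_neighborFinset _ _ _).1 hv).symm w
    rw [h.hasWalk_iff (by omega)]
    exact ⟨fun h => by omega, fun h => by rw [h]; simp⟩
  have h2 : {x ∈ G.neighborFinset w | HasWalk G (d - 1) u x} =
      {x ∈ G.neighborFinset w | G.dist u x = d - 1} := by
    refine Finset.filter_congr fun v hv => ?_
    have := h.dist_le_add_one u ((mem_neighborFinset _ _ _).1 hv).symm
    rw [h.hasWalk_iff (by omega)]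
    exact ⟨fun h => by omega, fun h => by rw [h]; simp⟩
  rw [h1, h2] at this
  exact_mod_cast this.symm

end HasExcessFour
end Counting
end BipartiteExcess

/-! ### No edge joins two vertices equidistant from a third. -/

namespace BipartiteExcess
open SimpleGraph

set_option linter.unusedSectionVars false

/-- The neighbours of `u` at distance `d - 1` from `w`. -/
noncomputable def geodesicNeighbors {V : Type*} [Fintype V] (G : SimpleGraph V) [DecidableRel G.Adj] (d : ℕ)
    (u w : V) : Finset V :=
  {v ∈ G.neighborFinset u | G.dist v w = d - 1}

/-- The neighbours of `w` at distance at least `d` from `u`. -/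
noncomputable def outerNeighbors {V : Type*} [Fintype V] (G : SimpleGraph V) [DecidableRel G.Adj] (d : ℕ)
    (u w : V) : Finset V :=
  {z ∈ G.neighborFinset w | d ≤ G.dist u z}

namespace HasExcessFour
variable {V : Type*} [Fintype V] [DecidableEq V] {G : SimpleGraph V} [DecidableRel G.Adj]
  {k d : ℕ} (h : HasExcessFour G k d) {u v w x y z w' y' z' : V}

lemma mem_geodesicNeighbors :
    v ∈ geodesicNeighbors G d u w ↔ G.Adj u v ∧ G.dist v w = d - 1 := by
  simp [geodesicNeighbors]

lemma mem_outerNeighbors : z ∈ outerNeighbors G d u w ↔ G.Adj w z ∧ d ≤ G.dist u z := by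
  simp [outerNeighbors]

lemma geodesicNeighbors_subset : geodesicNeighbors G d u w ⊆ G.neighborFinset u :=
  Finset.filter_subset _ _

include h

lemma card_geodesicNeighbors_add (hw : G.dist u w = d) :
    (geodesicNeighbors G d u w).card + (outerNeighbors G d u w).card = k := by
  rw [geodesicNeighbors, h.card_geodesic_ends hw, ← h.regular w, ← G.card_neighborFinset_eq_degree w,
    outerNeighbors,
    ← Finset.card_filter_add_card_filter_not (s := G.neighborFinset w)
      (fun x => G.dist u x = d - 1)]
  congr 2
  refine Finset.filter_congr fun z hz => ?_
  have := h.dist_le_add_one u ((mem_neighborFinset _ _ _).1 hz).symm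
  have := h.three_le
  omega

lemma geodesicNeighbors_nonempty (hw : G.dist u w = d) : (geodesicNeighbors G d u w).Nonempty := by
  have hd := h.three_le
  obtain ⟨p, hp⟩ := h.hasWalk_dist w u
  have : HasWalk G (d - 1 + 1) w u := ⟨p, by rw [hp, dist_comm, hw]; omega⟩
  obtain ⟨v, hv, hwv⟩ := hasWalk_succ.1 this
  refine ⟨v, mem_geodesicNeighbors.2 ⟨hv.symm, ?_⟩⟩
  have h1 := hwv.symm.dist_le
  have h2 := h.dist_le_add_one' hv w
  omega

/-- Since z is at distance at least d-1 from v and is adjacent to w, which is at distance exactly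
d-1, the girth excludes d-1 for z. -/
lemma outerNeighbors_subset (hv : v ∈ geodesicNeighbors G d u w) :
    outerNeighbors G d u w ⊆ ({x | d ≤ G.dist u x ∧ d ≤ G.dist v x} : Finset V) := by
  intro z hz
  obtain ⟨huv, hvw⟩ := mem_geodesicNeighbors.1 hv
  obtain ⟨hwz, huz⟩ := mem_outerNeighbors.1 hz
  have hd := h.three_le
  have h1 := h.dist_ne_of_adj (u := v) hwz (by omega)
  have h2 := h.dist_le_add_one' huv.symm z
  simp only [Finset.mem_filter, Finset.mem_univ, true_and]
  omega

lemma far_subset (huv : G.Adj u v) : ({x | d + 1 ≤ G.dist u x} : Finset V) ⊆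
    ({x | d ≤ G.dist u x ∧ d ≤ G.dist v x} : Finset V) := by
  intro z hz
  have h2 := h.dist_le_add_one' huv.symm z
  simp only [Finset.mem_filter, Finset.mem_univ, true_and] at hz ⊢
  omega

lemma card_far_le (u : V) : ({x | d + 1 ≤ G.dist u x} : Finset V).card ≤ 4 := by
  obtain ⟨v, hv⟩ := h.exists_adj u
  rw [← h.card_far hv]
  exact Finset.card_le_card (h.far_subset hv)

lemma card_outerNeighbors_le (hw : G.dist u w = d) : (outerNeighbors G d u w).card ≤ 4 := by
  obtain ⟨v, hv⟩ := h.geodesicNeighbors_nonempty hw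
  rw [← h.card_far (mem_geodesicNeighbors.1 hv).1]
  exact Finset.card_le_card (h.outerNeighbors_subset hv)

lemma disjoint_geodesicNeighbors (hz : G.dist u z = d) (hwz : G.Adj w z) :
    Disjoint (geodesicNeighbors G d u w) (geodesicNeighbors G d u z) := by
  rw [Finset.disjoint_left]
  intro v hv hv'
  have h1 := h.outerNeighbors_subset hv (mem_outerNeighbors.2 ⟨hwz, hz.ge⟩)
  have h2 := (mem_geodesicNeighbors.1 hv').2
  have := h.three_le
  simp only [Finset.mem_filter, Finset.mem_univ, true_and] at h1
  omega

lemma card_outerNeighbors_inter_le (u : V) (hne : y ≠ y') :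
    (outerNeighbors G d u y ∩ outerNeighbors G d u y').card ≤ 1 := by
  rw [Finset.card_le_one]
  intro a ha b hb
  rw [Finset.mem_inter, mem_outerNeighbors, mem_outerNeighbors] at ha hb
  exact h.eq_of_common_neighbors hne ha.1.1 ha.2.1.symm hb.1.1 hb.2.1.symm

/-- A common v puts both outer sets among the same four far vertices, and they share at most one
since there are no 4-cycles. -/
lemma card_outerNeighbors_add_le (hne : y ≠ y')
    (hD : ¬ Disjoint (geodesicNeighbors G d u y) (geodesicNeighbors G d u y')) :
    (outerNeighbors G d u y).card + (outerNeighbors G d u y').card ≤ 5 := by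
  obtain ⟨v, hv, hv'⟩ := Finset.not_disjoint_iff.1 hD
  have h1 := Finset.card_le_card (Finset.union_subset (h.outerNeighbors_subset hv)
    (h.outerNeighbors_subset hv'))
  rw [h.card_far (mem_geodesicNeighbors.1 hv).1] at h1
  have h2 := h.card_outerNeighbors_inter_le u hne
  have h3 := Finset.card_union_add_card_inter (outerNeighbors G d u y) (outerNeighbors G d u y')
  omega

lemma card_add_le_of_disjoint
    (hD : Disjoint (geodesicNeighbors G d u y) (geodesicNeighbors G d u y')) :
    (geodesicNeighbors G d u y).card + (geodesicNeighbors G d u y').card ≤ k := by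
  rw [← Finset.card_union_of_disjoint hD, ← h.regular u, ← G.card_neighborFinset_eq_degree u]
  exact Finset.card_le_card (Finset.union_subset geodesicNeighbors_subset geodesicNeighbors_subset)

/-- The one numerical pattern that the general count in `not_adj_of_dist_eq` leaves open. The second
outer neighbour y of z either lies on the sphere and overfills the six neighbours of u, or lies
beyond it. In the latter case y is an outer neighbour of w, whose four outer neighbours exhaust the
far set, and w, z, y form a triangle. -/
lemma not_adj_of_card_eq_four (hk : k = 6) (hw : G.dist u w = d) (hz : G.dist u z = d)
    (hwc : (geodesicNeighbors G d u w).card = 2) (hzc : (geodesicNeighbors G d u z).card = 4) :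
    ¬ G.Adj w z := by
  intro hwz
  have hw1 := h.card_geodesicNeighbors_add hw
  have hz1 := h.card_geodesicNeighbors_add hz
  obtain ⟨y, hy, hyw⟩ := Finset.exists_mem_ne
    (show 1 < (outerNeighbors G d u z).card by omega) w
  obtain ⟨hzy, huy⟩ := mem_outerNeighbors.1 hy
  rcases huy.eq_or_lt with huy | huy
  · have hy1 := h.card_geodesicNeighbors_add huy.symm
    have h1 := h.disjoint_geodesicNeighbors huy.symm hzy
    have h2 := h.disjoint_geodesicNeighbors hz hwz
    have h3 := h.card_add_le_of_disjoint h1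
    by_cases h4 : Disjoint (geodesicNeighbors G d u y) (geodesicNeighbors G d u w)
    · have h5 := Finset.card_union_of_disjoint h4
      have h6 : Disjoint (geodesicNeighbors G d u y ∪ geodesicNeighbors G d u w)
        (geodesicNeighbors G d u z) := Finset.disjoint_union_left.2 ⟨h1.symm, h2⟩
      have h7 := Finset.card_union_of_disjoint h6
      have h8 := Finset.card_le_card (Finset.union_subset (Finset.union_subset
        (geodesicNeighbors_subset (G := G) (d := d) (u := u) (w := y))
        (geodesicNeighbors_subset (d := d) (w := w)))
        (geodesicNeighbors_subset (d := d) (w := z)))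
      rw [G.card_neighborFinset_eq_degree u, h.regular u] at h8
      have h9 := (h.geodesicNeighbors_nonempty huy.symm).card_pos
      omega
    · have := h.card_outerNeighbors_add_le hyw h4
      omega
  · obtain ⟨v, hv⟩ := h.geodesicNeighbors_nonempty hw
    have huv := (mem_geodesicNeighbors.1 hv).1
    have h1 := Finset.eq_of_subset_of_card_le (h.outerNeighbors_subset hv)
      (by rw [h.card_far huv]; omega)
    have h2 := h.far_subset huv (show y ∈ _ by simpa using huy)
    rw [← h1, mem_outerNeighbors] at h2
    exact h.not_adj_of_adj_adj hwz hzy h2.1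

/-- There are no edges within the sphere of radius `d`. -/
lemma not_adj_of_dist_eq (hw : G.dist u w = d) (hw' : G.dist u w' = d) : ¬ G.Adj w w' := by
  intro hadj
  have hk := h.six_le
  have hd := h.three_le
  have c1 := h.card_geodesicNeighbors_add hw
  have c2 := h.card_geodesicNeighbors_add hw'
  have b2 := h.card_outerNeighbors_le hw'
  set N := {z ∈ outerNeighbors G d u w' | G.dist u z = d} with hN
  set F := {z ∈ outerNeighbors G d u w' | ¬ G.dist u z = d} with hF
  have hNF : N.card + F.card = (outerNeighbors G d u w').card :=
    Finset.card_filter_add_card_filter_not _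
  have hNmem : ∀ z ∈ N, G.Adj w' z ∧ G.dist u z = d := by
    intro z hz
    rw [hN, Finset.mem_filter, mem_outerNeighbors] at hz
    exact ⟨hz.1.1, hz.2⟩
  have hwN : w ∈ N := by
    rw [hN, Finset.mem_filter, mem_outerNeighbors]
    exact ⟨⟨hadj.symm, hw.ge⟩, hw⟩
  by_cases hpd : (N : Set V).PairwiseDisjoint (geodesicNeighbors G d u)
  · have h1 := Finset.card_biUnion (s := N) (t := geodesicNeighbors G d u)
      (fun x hx y hy hxy => hpd hx hy hxy)
    have h2 : Disjoint (N.biUnion (geodesicNeighbors G d u)) (geodesicNeighbors G d u w') := by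
      rw [Finset.disjoint_biUnion_left]
      intro z hz
      exact h.disjoint_geodesicNeighbors hw' (hNmem z hz).1.symm
    have h3 := Finset.card_union_of_disjoint h2
    have h4 : (N.biUnion (geodesicNeighbors G d u) ∪ geodesicNeighbors G d u w').card ≤ k := by
      rw [← h.regular u, ← G.card_neighborFinset_eq_degree u]
      exact Finset.card_le_card (Finset.union_subset
        (Finset.biUnion_subset.2 fun _ _ => geodesicNeighbors_subset) geodesicNeighbors_subset)
    have h5 := Finset.add_sum_erase N (fun z => (geodesicNeighbors G d u z).card) hwN
    -- Each geodesic set has at least k - 4 ≥ 2 elements.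
    have h6 : (N.erase w).card * 2 ≤ ∑ z ∈ N.erase w, (geodesicNeighbors G d u z).card := by
      rw [← smul_eq_mul]
      refine Finset.card_nsmul_le_sum _ _ _ fun z hz => ?_
      have hz' := (hNmem z (Finset.mem_of_mem_erase hz)).2
      have := h.card_geodesicNeighbors_add hz'
      have := h.card_outerNeighbors_le hz'
      omega
    have h7 := Finset.card_erase_add_one hwN
    obtain ⟨v, hv⟩ := h.geodesicNeighbors_nonempty hw
    have huv := (mem_geodesicNeighbors.1 hv).1
    have h8 : Disjoint (outerNeighbors G d u w) F := by
      rw [Finset.disjoint_left]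
      intro z hz hz'
      rw [hF, Finset.mem_filter, mem_outerNeighbors] at hz'
      exact h.not_adj_of_adj_adj hadj hz'.1.1 (mem_outerNeighbors.1 hz).1
    have h9 : (outerNeighbors G d u w ∪ F).card ≤ 4 := by
      rw [← h.card_far huv]
      refine Finset.card_le_card (Finset.union_subset (h.outerNeighbors_subset hv) ?_)
      refine subset_trans ?_ (h.far_subset huv)
      intro z hz
      rw [hF, Finset.mem_filter, mem_outerNeighbors] at hz
      simp only [Finset.mem_filter, Finset.mem_univ, true_and]
      omega
    -- Packing the geodesic sets of w' and of N into the neighbours of u gives k + |N| - 2 ≤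
    -- |outer(w)| + |F| ≤ 4, impossible for k ≥ 6 and N nonempty.
    rw [Finset.card_union_of_disjoint h8] at h9
    omega
  · simp only [Set.PairwiseDisjoint, Set.Pairwise, not_forall] at hpd
    obtain ⟨z, hz, z', hz', hne, hnd⟩ := hpd
    obtain ⟨az, dz⟩ := hNmem z hz
    obtain ⟨az', dz'⟩ := hNmem z' hz'
    have h1 := h.card_outerNeighbors_add_le hne hnd
    have h2 := h.card_geodesicNeighbors_add dz
    have h3 := h.card_geodesicNeighbors_add dz'
    have h4 := h.card_add_le_of_disjoint (h.disjoint_geodesicNeighbors dz az)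
    have h5 := h.card_add_le_of_disjoint (h.disjoint_geodesicNeighbors dz' az')
    -- Both geodesic sets have at most 4 elements, because that of w' has at least k - 4, and
    -- together they have at least 2k - 5. So k = 6 and one of them has exactly 4.
    have h6 : (geodesicNeighbors G d u z).card = 4 ∨ (geodesicNeighbors G d u z').card = 4 := by
      omega
    rcases h6 with h6 | h6
    · exact h.not_adj_of_card_eq_four (by omega) hw' dz (by omega) h6 az
    · exact h.not_adj_of_card_eq_four (by omega) hw' dz' (by omega) h6 az'

lemma exists_adj_dist_eq (hx : d + 1 ≤ G.dist u x) : ∃ y, G.Adj x y ∧ G.dist u y = d := by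
  have hk := h.six_le
  have h1 := h.card_far_le u
  have h2 : ¬ G.neighborFinset x ⊆ ({x | d + 1 ≤ G.dist u x} : Finset V) := by
    intro hc
    have := Finset.card_le_card hc
    rw [card_neighborFinset_eq_degree, h.regular x] at this
    omega
  obtain ⟨y, hy, hy'⟩ := Finset.not_subset.1 h2
  rw [mem_neighborFinset] at hy
  have := h.dist_le_add_one u hy.symm
  simp only [Finset.mem_filter, Finset.mem_univ, true_and] at hy'
  exact ⟨y, hy, by omega⟩

lemma dist_le (u x : V) : G.dist u x ≤ d + 1 := by
  by_contra hc
  obtain ⟨y, hy, hd⟩ := h.exists_adj_dist_eq (u := u) (x := x) (by omega)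
  have := h.dist_le_add_one u hy.symm
  omega

/-- There are no edges outside the ball of radius `d`. -/
lemma not_adj_of_lt_dist (hw : d + 1 ≤ G.dist u w) (hw' : d + 1 ≤ G.dist u w') :
    ¬ G.Adj w w' := by
  intro hadj
  have hk := h.six_le
  have hd := h.three_le
  obtain ⟨y, hwy, hy⟩ := h.exists_adj_dist_eq hw
  obtain ⟨y', hwy', hy'⟩ := h.exists_adj_dist_eq hw'
  set F := ({x | d + 1 ≤ G.dist u x} : Finset V) with hF
  have hFc : F.card ≤ 4 := h.card_far_le u
  have key : ∀ {a b c : V}, G.dist u a = d → G.Adj b a → G.Adj b c → d + 1 ≤ G.dist u c →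
      outerNeighbors G d u a ⊆ F.erase c := by
    intro a b c ha hba hbc hc z hz
    obtain ⟨haz, huz⟩ := mem_outerNeighbors.1 hz
    rw [Finset.mem_erase]
    constructor
    · rintro rfl
      exact h.not_adj_of_adj_adj hba haz hbc
    · have : G.dist u z ≠ d := fun he => h.not_adj_of_dist_eq ha he haz
      rw [hF, Finset.mem_filter]
      exact ⟨Finset.mem_univ _, by omega⟩
  have s1 := key hy hwy hadj hw'
  have s2 := key hy' hwy' hadj.symm hw
  have e1 := Finset.card_le_card s1
  have e2 := Finset.card_le_card s2
  rw [Finset.card_erase_of_mem (by simpa [hF] using hw')] at e1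
  rw [Finset.card_erase_of_mem (by simpa [hF] using hw)] at e2
  have c1 := h.card_geodesicNeighbors_add hy
  have c2 := h.card_geodesicNeighbors_add hy'
  -- A common v would have both w and w' at distance exactly d, and the sphere around v contains no
  -- edge.
  have hdisj : Disjoint (geodesicNeighbors G d u y) (geodesicNeighbors G d u y') := by
    rw [Finset.disjoint_left]
    intro v hv hv'
    obtain ⟨huv, h1⟩ := mem_geodesicNeighbors.1 hv
    obtain ⟨-, h2⟩ := mem_geodesicNeighbors.1 hv'
    have h3 := h.dist_le_add_one v hwy.symm
    have h4 := h.dist_le_add_one v hwy'.symm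
    have h5 := h.dist_le_add_one' huv.symm w
    have h6 := h.dist_le_add_one' huv.symm w'
    exact h.not_adj_of_dist_eq (u := v) (by omega) (by omega) hadj
  have c3 := h.card_add_le_of_disjoint hdisj
  have hne : y ≠ y' := by
    rintro rfl
    exact h.not_adj_of_adj_adj hwy hwy'.symm hadj
  have c4 := h.card_outerNeighbors_inter_le u hne
  have c5 := Finset.card_union_add_card_inter (outerNeighbors G d u y) (outerNeighbors G d u y')
  have c6 := Finset.card_le_card (Finset.union_subset (s1.trans (Finset.erase_subset _ _))
    (s2.trans (Finset.erase_subset _ _)))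
  -- Disjointness forces the outer sets to have total size at least k ≥ 6, but they share at most
  -- one vertex and their union has at most 4.
  omega

lemma dist_ne (u : V) (hadj : G.Adj v w) : G.dist u w ≠ G.dist u v := by
  intro he
  rcases lt_trichotomy (G.dist u v) d with hd | hd | hd
  · exact h.dist_ne_of_adj hadj hd he
  · exact h.not_adj_of_dist_eq hd (he.trans hd) hadj
  · exact h.not_adj_of_lt_dist hd (by omega) hadj

lemma even_dist_iff (u : V) (hadj : G.Adj v w) : Even (G.dist u w) ↔ ¬ Even (G.dist u v) := by
  have h1 := h.dist_ne u hadj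
  have h2 := h.dist_le_add_one u hadj
  have h3 := h.dist_le_add_one u hadj.symm
  rcases (by omega : G.dist u w = G.dist u v + 1 ∨ G.dist u v = G.dist u w + 1) with h4 | h4
  · rw [h4, Nat.even_add_one]
  · rw [h4, Nat.even_add_one, not_not]

lemma isBipartite : G.IsBipartite := by
  obtain ⟨r⟩ := h.connected.nonempty
  have c : G.Coloring Bool := Coloring.mk (fun v => decide (Even (G.dist r v))) (by
    intro v w hvw
    have := h.even_dist_iff r hvw
    simp only [ne_eq, decide_eq_decide]
    tauto)
  simpa using c.colorable

end HasExcessFour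
end BipartiteExcess

/-! ### The excess matrix as a polynomial in A plus two rank-one terms. -/

namespace BipartiteExcess
open SimpleGraph Matrix

set_option linter.unusedSectionVars false

lemma excessMatrix_eq_adjMatrix {V : Type*} (G : SimpleGraph V) (d : ℕ) :
    excessMatrix G d = (excessGraph G d).adjMatrix ℝ := by
  ext u v
  rw [adjMatrix_apply]
  rfl

namespace HasExcessFour
variable {V : Type*} [Fintype V] [DecidableEq V] {G : SimpleGraph V} [DecidableRel G.Adj]
  {k d : ℕ} (h : HasExcessFour G k d) {s : V → ℝ}
include h

lemma exists_sign : ∃ s : V → ℝ, ∀ u v, s u * s v = (-1) ^ G.dist u v := by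
  have c : G.Coloring Bool := Colorable.toColoring h.isBipartite (by simp)
  refine ⟨fun v => if c v then 1 else -1, fun u v => ?_⟩
  obtain ⟨p, hp⟩ := h.hasWalk_dist u v
  have := c.even_length_iff_congr p
  rw [hp] at this
  by_cases he : Even (G.dist u v)
  · rw [he.neg_one_pow]
    have h1 := this.1 he
    by_cases hu : c u <;> by_cases hv : c v <;> simp_all
  · rw [(Nat.not_even_iff_odd.1 he).neg_one_pow]
    have h1 := fun h2 => he (this.2 h2)
    by_cases hu : c u <;> by_cases hv : c v <;> simp_all

lemma sign_mul_self (hs : ∀ u v, s u * s v = (-1) ^ G.dist u v) (u : V) : s u * s u = 1 := by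
  simp [hs]

lemma adjMatrix_mulVec_sign (hs : ∀ u v, s u * s v = (-1) ^ G.dist u v) :
    (G.adjMatrix ℝ).mulVec s = (-(k : ℝ)) • s := by
  ext v
  rw [adjMatrix_mulVec_apply]
  have : ∀ x ∈ G.neighborFinset v, s x = - s v := by
    intro x hx
    rw [mem_neighborFinset] at hx
    have h1 := hs v x
    rw [dist_eq_one_iff_adj.2 hx] at h1
    have h2 := h.sign_mul_self hs v
    linear_combination s v * h1 - s x * h2
  rw [Finset.sum_congr rfl this, Finset.sum_const, card_neighborFinset_eq_degree, h.regular v]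
  simp

lemma sum_sign (hs : ∀ u v, s u * s v = (-1) ^ G.dist u v) : ∑ v, s v = 0 := by
  have h1 : (fun _ => (1 : ℝ)) ⬝ᵥ ((G.adjMatrix ℝ).mulVec s) = (k : ℝ) * ∑ v, s v := by
    rw [dotProduct_mulVec, ← mulVec_transpose, transpose_adjMatrix, adjMatrix_mulVec_one h.regular]
    simp [dotProduct, Finset.mul_sum]
  rw [h.adjMatrix_mulVec_sign hs] at h1
  simp only [dotProduct, one_mul, Pi.smul_apply, smul_eq_mul, ← Finset.mul_sum] at h1
  have : (6 : ℝ) ≤ k := by exact_mod_cast h.six_le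
  nlinarith

/-- `E = (J ± s sᵀ) / 2 - H_{d-1}(A)`. -/
lemma excessMatrix_eq (hs : ∀ u v, s u * s v = (-1) ^ G.dist u v) :
    excessMatrix G d = -Polynomial.aeval (G.adjMatrix ℝ) (H k (d - 1)) +
      vecMulVec (fun _ => 1) (fun _ => 1 / 2) +
      vecMulVec s (((-1) ^ (d - 1) / 2 : ℝ) • s) := by
  classical
  have hk := h.six_le
  have hd := h.three_le
  ext u v
  have hdi := h.dist_le u v
  simp only [excessMatrix, Matrix.of_apply, Matrix.add_apply, Matrix.neg_apply,
    vecMulVec_apply, Pi.smul_apply, smul_eq_mul,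
    aeval_H_apply h.regular (by omega) h.le_egirth (show d - 1 < d by omega),
    h.hasWalk_iff (show d - 1 < d by omega)]
  rw [show s u * ((-1) ^ (d - 1) / 2 * s v) = (s u * s v) * (-1) ^ (d - 1) / 2 by ring, hs,
    ← pow_add]
  by_cases hp : Even (G.dist u v) ↔ Even (d - 1)
  · rw [(Nat.even_add.2 hp).neg_one_pow]
    have h1 : G.dist u v ≠ d := by
      intro he
      rw [he] at hp
      nth_rewrite 1 [show d = d - 1 + 1 by omega] at hp
      rw [Nat.even_add_one] at hp
      tauto
    by_cases h2 : G.dist u v = d + 1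
    · rw [if_pos h2, if_neg (by omega)]
      norm_num
    · rw [if_neg h2, if_pos ⟨by omega, hp⟩]
      norm_num
  · rw [(Nat.not_even_iff_odd.1 (fun h => hp (Nat.even_add.1 h))).neg_one_pow,
      if_neg (fun h2 : _ ∧ _ => hp h2.2), if_neg]
    · norm_num
    · intro he
      apply hp
      rw [he, show d + 1 = d - 1 + 2 by omega]
      simp [parity_simps]

lemma card_div_two : (Fintype.card V : ℝ) / 2 = (H k (d - 1)).eval (k : ℝ) + 2 := by
  rw [h.eval_H_eq, h.card_eq]
  push_cast
  ring

/-- Apply the formula for E to the all-ones vector: J/2 contributes n/2 = H_{d-1}(k) + 2, and the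
sign term vanishes because s sums to 0. -/
lemma degree_excessGraph (u : V) : (excessGraph G d).degree u = 2 := by
  obtain ⟨s, hs⟩ := h.exists_sign
  have h1 : ((excessGraph G d).adjMatrix ℝ).mulVec (fun _ => 1) u = 2 := by
    rw [← excessMatrix_eq_adjMatrix, h.excessMatrix_eq hs, add_mulVec, add_mulVec, neg_mulVec,
      aeval_mulVec_of_mulVec_eq_smul (adjMatrix_mulVec_one h.regular)]
    have h2 := h.card_div_two
    have h3 : s ⬝ᵥ (fun _ => (1 : ℝ)) = 0 := by simp [dotProduct, h.sum_sign hs]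
    simp only [vecMulVec_mulVec, smul_dotProduct, h3]
    simp [dotProduct]
    linarith
  rw [adjMatrix_mulVec_apply] at h1
  simp only [Finset.sum_const, card_neighborFinset_eq_degree, nsmul_eq_mul, mul_one] at h1
  exact_mod_cast h1

end HasExcessFour
end BipartiteExcess

/-! ### Finite 2-regular graphs are unions of cycles. -/

namespace BipartiteExcess
open SimpleGraph

section TwoRegular
variable {V : Type*} {G : SimpleGraph V}

lemma cycleUnion_adj {c : ℕ} {l : Fin c → ℕ} {i j : Fin c} {x : Fin (l i)} {y : Fin (l j)} :
    (cycleUnion l).Adj ⟨i, x⟩ ⟨j, y⟩ ↔ ∃ h : i = j, (cycleGraph (l j)).Adj (h ▸ x) y := by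
  constructor
  · rintro ⟨i', x', y', hp, hq, h⟩
    cases hp
    cases hq
    exact ⟨rfl, h⟩
  · rintro ⟨rfl, h⟩
    exact ⟨i, x, y, rfl, rfl, h⟩

lemma ncard_neighborSet_cycleUnion {c : ℕ} {l : Fin c → ℕ} (hl : ∀ i, 3 ≤ l i)
    (a : Σ i : Fin c, Fin (l i)) : ((cycleUnion l).neighborSet a).ncard = 2 := by
  classical
  obtain ⟨i, x⟩ := a
  have h1 : (cycleUnion l).neighborSet ⟨i, x⟩ =
      Sigma.mk i '' (cycleGraph (l i)).neighborSet x := by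
    ext ⟨j, y⟩
    rw [mem_neighborSet, cycleUnion_adj]
    constructor
    · rintro ⟨rfl, h⟩
      exact ⟨y, h, rfl⟩
    · rintro ⟨z, hz, he⟩
      cases he
      exact ⟨rfl, hz⟩
  rw [h1, Set.ncard_image_of_injective _ sigma_mk_injective]
  have h2 : ∀ {n : ℕ} (_ : 3 ≤ n) (x : Fin n), ((cycleGraph n).neighborSet x).ncard = 2 := by
    intro n hn x
    obtain ⟨m, rfl⟩ := Nat.exists_eq_add_of_le' hn
    rw [← cycleGraph_degree_three_le (v := x), ← card_neighborSet_eq_degree,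
      Set.ncard_eq_toFinset_card', Set.toFinset_card]
  exact h2 (hl i) x

lemma adj_getVert_of_cycleGraph_adj {v : V} {p : G.Walk v v} {x y : Fin p.length}
    (hxy : (cycleGraph p.length).Adj x y) : G.Adj (p.getVert x) (p.getVert y) := by
  have key : ∀ {x y : Fin p.length}, (y - x).val = 1 → G.Adj (p.getVert x) (p.getVert y) := by
    intro x y h
    have hx := x.2
    have hy := y.2
    rw [Fin.val_sub] at h
    rcases Nat.lt_or_ge (p.length - x + y) p.length with h1 | h1
    · rw [Nat.mod_eq_of_lt h1] at h
      have h2 := p.adj_getVert_succ hx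
      have h3 : p.getVert (x + 1) = p.getVert y := by
        rw [show (x : ℕ) + 1 = p.length by omega, show (y : ℕ) = 0 by omega]
        simp
      rwa [h3] at h2
    · rw [Nat.mod_eq_sub_mod h1, Nat.mod_eq_of_lt (by omega)] at h
      have h2 := p.adj_getVert_succ hx
      rwa [show (x : ℕ) + 1 = y by omega] at h2
  rcases cycleGraph_adj'.1 hxy with h | h
  · exact (key h).symm
  · exact key h

/-- A finite graph all of whose vertices have two neighbours is a disjoint union of cycles. -/
theorem exists_iso_cycleUnion [Finite V] (hG : ∀ v, (G.neighborSet v).ncard = 2) :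
    ∃ (c : ℕ) (l : Fin c → ℕ) (_ : cycleUnion l ≃g G), ∀ i, 3 ≤ l i := by
  classical
  have hcyc : G.IsCycles := fun v _ => hG v
  have hne : ∀ v, (G.neighborSet v).Nonempty := fun v =>
    Set.nonempty_of_ncard_ne_zero (by rw [hG v]; decide)
  have hex : ∀ C : G.ConnectedComponent, ∃ (v : V) (p : G.Walk v v), p.IsCycle ∧
      p.toSubgraph.verts = C.supp := by
    intro C
    obtain ⟨v, hv⟩ := C.nonempty_supp
    exact ⟨v, hcyc.exists_cycle_toSubgraph_verts_eq_connectedComponentSupp hv (hne v)⟩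
  choose b p hp hsupp using hex
  obtain ⟨c, ⟨e⟩⟩ := Finite.exists_equiv_fin G.ConnectedComponent
  have hl : ∀ i, 3 ≤ (p (e.symm i)).length := fun i => (hp _).three_le_length
  let f : (Σ i : Fin c, Fin (p (e.symm i)).length) → V :=
    fun a => (p (e.symm a.1)).getVert a.2
  have hcomp : ∀ a, G.connectedComponentMk (f a) = e.symm a.1 := by
    intro a
    have : f a ∈ (p (e.symm a.1)).toSubgraph.verts :=
      (Walk.mem_verts_toSubgraph _).2 (Walk.getVert_mem_support _ _)
    rw [hsupp] at this
    exact this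
  have hinj : Function.Injective f := by
    rintro ⟨i, x⟩ ⟨j, y⟩ hab
    have h1 := hcomp ⟨i, x⟩
    rw [hab, hcomp ⟨j, y⟩] at h1
    obtain rfl : j = i := e.symm.injective h1
    congr 1
    have hx := x.2
    have hy := y.2
    exact Fin.ext ((hp _).getVert_injOn' (by simp only [Set.mem_ofPred_eq]; omega)
      (by simp only [Set.mem_ofPred_eq]; omega) hab)
  have hsurj : Function.Surjective f := by
    intro v
    have h1 : v ∈ (p (G.connectedComponentMk v)).toSubgraph.verts := by
      rw [hsupp]
      rfl
    rw [Walk.mem_verts_toSubgraph, Walk.mem_support_iff_exists_getVert] at h1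
    obtain ⟨n, hn, hnl⟩ := h1
    have h3 := (hp (G.connectedComponentMk v)).three_le_length
    have key : ∀ m, (hm : m < (p (G.connectedComponentMk v)).length) →
        (p (G.connectedComponentMk v)).getVert m = v → ∃ a, f a = v := by
      intro m hm hv
      generalize hC : G.connectedComponentMk v = C at *
      obtain ⟨i, rfl⟩ := e.symm.surjective C
      exact ⟨⟨i, ⟨m, hm⟩⟩, hv⟩
    -- The last index of the closed walk is not an element of `Fin p.length`; it is replaced by
    -- index 0, the same vertex.
    rcases hnl.eq_or_lt with h2 | h2
    · refine key 0 (by omega) ?_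
      rw [h2, Walk.getVert_length] at hn
      rw [Walk.getVert_zero, hn]
    · exact key n h2 hn
  have hadj : ∀ a a', (cycleUnion fun i => (p (e.symm i)).length).Adj a a' → G.Adj (f a) (f a') := by
    rintro ⟨i, x⟩ ⟨j, y⟩ h
    obtain ⟨rfl, h⟩ := cycleUnion_adj.1 h
    exact adj_getVert_of_cycleGraph_adj h
  refine ⟨c, fun i => (p (e.symm i)).length, ⟨Equiv.ofBijective f ⟨hinj, hsurj⟩, ?_⟩, hl⟩
  intro a a'
  refine ⟨fun h => ?_, hadj a a'⟩
  -- Two neighbours map injectively into a set of two neighbours, so they fill it, and adjacency is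
  -- reflected as well as preserved.
  have h1 : f '' (cycleUnion fun i => (p (e.symm i)).length).neighborSet a = G.neighborSet (f a) := by
    refine Set.eq_of_subset_of_ncard_le ?_ ?_ (Set.toFinite _)
    · rintro _ ⟨a'', h, rfl⟩
      exact hadj _ _ h
    · rw [hG, Set.ncard_image_of_injective _ hinj, ncard_neighborSet_cycleUnion hl]
  have h2 : f a' ∈ G.neighborSet (f a) := h
  rw [← h1] at h2
  obtain ⟨a'', h3, h4⟩ := h2
  rwa [hinj h4] at h3

end TwoRegular
end BipartiteExcess

/-! ### Characteristic polynomials: rank-one perturbations and polynomials in a matrix. -/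

namespace BipartiteExcess
open Matrix Polynomial

section RankOne
variable {n R : Type*} [Fintype n] [DecidableEq n] [CommRing R] [IsDomain R]

/-- As M v wᵀ = 0, (X - M)(X - v wᵀ) = X (X - M - v wᵀ); take determinants. Brauer's theorem follows
by shifting M by the eigenvalue. -/
lemma charpoly_add_vecMulVec_of_mulVec_eq_zero {M : Matrix n n R} {v : n → R} (w : n → R)
    (hv : M *ᵥ v = 0) :
    (M + vecMulVec v w).charpoly * X = M.charpoly * (X - C (v ⬝ᵥ w)) := by
  rcases isEmpty_or_nonempty n with hn | hn
  · simp
  have hp : 0 < Fintype.card n := Fintype.card_pos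
  have h1 : M.charmatrix * (vecMulVec v w).charmatrix =
      (X : R[X]) • (M + vecMulVec v w).charmatrix := by
    have h2 : (C.mapMatrix M) * (C.mapMatrix (vecMulVec v w)) = 0 := by
      rw [← map_mul, mul_vecMulVec, hv, zero_vecMulVec, map_zero]
    simp only [charmatrix, map_add, sub_mul, mul_sub, h2, ← Matrix.smul_one_eq_diagonal,
      scalar_apply, smul_mul_assoc, mul_smul_comm, one_mul, mul_one, smul_sub, smul_add]
    abel
  have h3 := congrArg Matrix.det h1
  rw [det_mul, det_smul] at h3
  change M.charpoly * (vecMulVec v w).charpoly = _ * (M + vecMulVec v w).charpoly at h3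
  rw [charpoly_vecMulVec] at h3
  have h4 : (X : R[X]) ^ Fintype.card n = X ^ (Fintype.card n - 1) * X := by
    rw [← pow_succ, Nat.sub_add_cancel hp]
  rw [h4] at h3
  apply mul_left_cancel₀ (pow_ne_zero (Fintype.card n - 1) (X_ne_zero (R := R)))
  rw [Polynomial.smul_eq_C_mul] at h3
  linear_combination -h3

/-- Brauer's theorem: a rank one perturbation along an eigenvector moves one eigenvalue. -/
lemma charpoly_add_vecMulVec {M : Matrix n n R} {v : n → R} {t : R} (w : n → R)
    (hv : M *ᵥ v = t • v) :
    (M + vecMulVec v w).charpoly * (X - C t) = M.charpoly * (X - C (t + v ⬝ᵥ w)) := by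
  have h1 := charpoly_add_vecMulVec_of_mulVec_eq_zero (M := M - Matrix.scalar n t)
    (v := v) w
    (by simp [sub_mulVec, hv, Matrix.diagonal_const_mulVec])
  rw [sub_add_eq_add_sub, charpoly_sub_scalar, charpoly_sub_scalar] at h1
  have h2 := congrArg (fun p => p.comp (X - C t)) h1
  simpa [comp_assoc, sub_sub] using h2

end RankOne

section Polynomial
variable {n : Type*} [Fintype n] [DecidableEq n]

lemma charpoly_aeval_roots {A : Matrix n n ℝ} (hA : A.IsHermitian) (p : ℝ[X]) :
    (aeval A p).charpoly.roots = A.charpoly.roots.map fun x => p.eval x := by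
  have h0 : ∀ q : ℝ[X], aeval (diagonal hA.eigenvalues) q =
      diagonal (fun i => q.eval (hA.eigenvalues i)) := by
    intro q
    have := Polynomial.aeval_algHom_apply (Matrix.diagonalAlgHom (n := n) (α := ℝ) ℝ)
      hA.eigenvalues q
    rw [Matrix.diagonalAlgHom_apply] at this
    rw [this, Matrix.diagonalAlgHom_apply]
    congr 1
    ext i
    simp [Polynomial.aeval_pi]
  have h1 : aeval A p = Unitary.conjStarAlgAut ℝ _ hA.eigenvectorUnitary
      (diagonal fun i => p.eval (hA.eigenvalues i)) := by
    conv_lhs => rw [hA.spectral_theorem]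
    rw [← h0]
    exact Polynomial.aeval_algHom_apply
      (Unitary.conjStarAlgAut ℝ _ hA.eigenvectorUnitary).toAlgEquiv.toAlgHom _ p
  have h2 : (aeval A p).charpoly = ∏ i, (X - C (p.eval (hA.eigenvalues i))) := by
    rw [h1, Unitary.conjStarAlgAut_apply, charpoly_mul_comm, ← mul_assoc]
    simp [charpoly_diagonal]
  rw [h2, hA.roots_charpoly_eq_eigenvalues, Finset.prod_eq_multiset_prod,
    Multiset.map_map]
  have h3 := Multiset.map_map (fun a : ℝ => X - C a) (fun i => p.eval (hA.eigenvalues i))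
    Finset.univ.val
  rw [Function.comp_def] at h3
  rw [← h3, Polynomial.roots_multiset_prod_X_sub_C]
  rfl

end Polynomial
end BipartiteExcess

/-! ### The spectrum of a disjoint union of cycles. -/

namespace BipartiteExcess
open SimpleGraph Matrix Polynomial

lemma exp_add_inv_exp_eq (N j : ℕ) :
    Complex.exp (2 * Real.pi * Complex.I / N) ^ j + (Complex.exp (2 * Real.pi * Complex.I / N) ^ j)⁻¹ =
      ((2 * Real.cos (2 * Real.pi * j / N) : ℝ) : ℂ) := by
  rw [← Complex.exp_nat_mul, ← Complex.exp_neg]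
  push_cast
  rw [Complex.cos, show (2 * Real.pi * j / N : ℂ) * Complex.I = j * (2 * Real.pi * Complex.I / N) by ring,
    show -(2 * Real.pi * j / N : ℂ) * Complex.I = -(j * (2 * Real.pi * Complex.I / N)) by ring]
  ring

/-- The discrete Fourier transform diagonalises the adjacency matrix of a cycle. -/
lemma adjMatrix_cycleGraph_mul_vandermonde {m : ℕ} {ζ : ℂ} (hζ : ζ ^ (m + 3) = 1) :
    (cycleGraph (m + 3)).adjMatrix ℂ * vandermonde (fun x : Fin (m + 3) => ζ ^ (x : ℕ)) =
      vandermonde (fun x : Fin (m + 3) => ζ ^ (x : ℕ)) *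
        diagonal (fun j : Fin (m + 3) => ζ ^ (j : ℕ) + (ζ ^ (j : ℕ))⁻¹) := by
  have hζ0 : ζ ≠ 0 := by
    rintro rfl
    simp at hζ
  have hsucc : ∀ y : Fin (m + 3), ζ ^ ((y + 1 : Fin (m + 3)) : ℕ) = ζ ^ (y : ℕ) * ζ := by
    intro y
    rw [← pow_succ, Fin.val_add, Fin.val_one, pow_eq_pow_mod _ hζ]
    rw [Nat.mod_mod]
    exact (pow_eq_pow_mod _ hζ).symm
  ext x j
  have hne : x - 1 ≠ x + 1 := by
    simp only [ne_eq, sub_eq_iff_eq_add, add_assoc x, left_eq_add]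
    exact ne_of_beq_false rfl
  have hpred : ζ ^ ((x - 1 : Fin (m + 3)) : ℕ) = ζ ^ (x : ℕ) * ζ⁻¹ := by
    have := hsucc (x - 1)
    rw [sub_add_cancel] at this
    rw [this]
    field_simp
  rw [adjMatrix_mul_apply, cycleGraph_neighborFinset, Finset.sum_pair hne, mul_diagonal]
  simp only [vandermonde_apply]
  rw [hsucc, hpred, mul_pow, mul_pow, inv_pow]
  ring

lemma charpoly_adjMatrix_cycleGraph {n : ℕ} (hn : 3 ≤ n) :
    ((cycleGraph n).adjMatrix ℝ).charpoly =
      ∏ j ∈ Finset.range n, (X - C (2 * Real.cos (2 * Real.pi * j / n))) := by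
  obtain ⟨m, rfl⟩ := Nat.exists_eq_add_of_le' hn
  have hprim := Complex.isPrimitiveRoot_exp (m + 3) (by omega)
  set ζ := Complex.exp (2 * Real.pi * Complex.I / ((m + 3 : ℕ) : ℂ)) with hζ
  have h1 := adjMatrix_cycleGraph_mul_vandermonde hprim.pow_eq_one
  have h2 : IsUnit (vandermonde (fun x : Fin (m + 3) => ζ ^ (x : ℕ))) := by
    rw [isUnit_iff_isUnit_det, isUnit_iff_ne_zero, det_vandermonde_ne_zero_iff]
    intro x y hxy
    exact Fin.ext (hprim.pow_inj x.2 y.2 hxy)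
  obtain ⟨U, hU⟩ := h2
  rw [← hU] at h1
  have h3 : (cycleGraph (m + 3)).adjMatrix ℂ =
      U.val * diagonal (fun j : Fin (m + 3) => ζ ^ (j : ℕ) + (ζ ^ (j : ℕ))⁻¹) * U⁻¹.val := by
    rw [← h1, mul_assoc, Units.mul_inv, mul_one]
  have h4 : ((cycleGraph (m + 3)).adjMatrix ℝ).map Complex.ofRealHom =
      (cycleGraph (m + 3)).adjMatrix ℂ := by
    ext x y
    simp only [map_apply, adjMatrix_apply]
    split_ifs <;> simp
  apply Polynomial.map_injective Complex.ofRealHom Complex.ofReal_injective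
  rw [← charpoly_map, h4, h3, coe_units_inv, charpoly_units_conj, charpoly_diagonal, Polynomial.map_prod,
    Finset.prod_range]
  refine Finset.prod_congr rfl fun j _ => ?_
  rw [hζ, exp_add_inv_exp_eq]
  simp

lemma det_blockDiagonal_sigma {o R : Type*} [Fintype o] [LinearOrder o] [CommRing R]
    {n : o → Type*} [∀ i, Fintype (n i)] [∀ i, DecidableEq (n i)]
    (M : ∀ i, Matrix (n i) (n i) R) : (blockDiagonal' M).det = ∏ i, (M i).det := by
  rw [(blockTriangular_blockDiagonal' M).det_fintype]
  refine Finset.prod_congr rfl fun i _ => ?_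
  rw [← det_submatrix_equiv_self (Equiv.sigmaSubtype i).symm]
  congr 1
  ext x y
  exact blockDiagonal'_apply_eq M i x y

open Classical in
lemma charpoly_adjMatrix_cycleUnion {c : ℕ} {l : Fin c → ℕ} (hl : ∀ i, 3 ≤ l i) :
    ((cycleUnion l).adjMatrix ℝ).charpoly =
      ∏ i, ∏ j ∈ Finset.range (l i), (X - C (2 * Real.cos (2 * Real.pi * j / l i))) := by
  have h1 : ((cycleUnion l).adjMatrix ℝ).charmatrix =
      blockDiagonal' fun i => ((cycleGraph (l i)).adjMatrix ℝ).charmatrix := by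
    ext1 ⟨i, x⟩ ⟨j, y⟩
    by_cases hij : i = j
    · subst hij
      rw [blockDiagonal'_apply_eq, charmatrix_apply, charmatrix_apply, adjMatrix_apply,
        adjMatrix_apply, diagonal_apply, diagonal_apply]
      simp [cycleUnion_adj]
    · rw [blockDiagonal'_apply_ne _ _ _ hij, charmatrix_apply_ne _ _ _ (by
        intro h; exact hij (congrArg Sigma.fst h)), adjMatrix_apply, if_neg]
      · simp
      · rw [cycleUnion_adj]
        exact fun ⟨h, _⟩ => hij h
  rw [Matrix.charpoly, h1, det_blockDiagonal_sigma]
  exact Finset.prod_congr rfl fun i _ => charpoly_adjMatrix_cycleGraph (hl i)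

open Classical in
lemma spectrumOf_adjMatrix_cycleUnion {c : ℕ} {l : Fin c → ℕ} (hl : ∀ i, 3 ≤ l i) :
    spectrumOf ((cycleUnion l).adjMatrix ℝ) = Multiset.replicate c 2 +
      (cycleIndices l).val.map (fun p => 2 * Real.cos (2 * Real.pi * p.2 / l p.1)) := by
  have h1 : ((cycleUnion l).adjMatrix ℝ).charpoly = (X - C 2) ^ c *
      ∏ p ∈ cycleIndices l, (X - C (2 * Real.cos (2 * Real.pi * p.2 / l p.1))) := by
    rw [charpoly_adjMatrix_cycleUnion hl, cycleIndices, Finset.prod_sigma]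
    -- The factor j = 0 is split off: it gives the eigenvalue 2 once for each cycle.
    have : ∀ i, ∏ j ∈ Finset.range (l i), (X - C (2 * Real.cos (2 * Real.pi * j / l i))) =
        (X - C (2 : ℝ)) * ∏ j ∈ Finset.Icc 1 (l i - 1),
          (X - C (2 * Real.cos (2 * Real.pi * j / l i))) := by
      intro i
      have h2 : Finset.range (l i) = insert 0 (Finset.Icc 1 (l i - 1)) := by
        ext j
        have := hl i
        simp only [Finset.mem_range, Finset.mem_insert, Finset.mem_Icc]
        omega
      rw [h2, Finset.prod_insert (by simp)]
      simp
    simp only [this, Finset.prod_mul_distrib, Finset.prod_const, Finset.card_univ, Fintype.card_fin]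
  have h3 : ∏ p ∈ cycleIndices l, (X - C (2 * Real.cos (2 * Real.pi * p.2 / l p.1))) ≠ 0 :=
    Finset.prod_ne_zero_iff.2 fun p _ => X_sub_C_ne_zero _
  rw [spectrumOf, h1, roots_mul (mul_ne_zero (pow_ne_zero _ (X_sub_C_ne_zero _)) h3), roots_pow,
    roots_X_sub_C, Multiset.nsmul_singleton, roots_prod _ _ h3]
  simp only [roots_X_sub_C, Multiset.bind_singleton]

end BipartiteExcess

/-! ### Comparing the spectra of A and E. -/

namespace BipartiteExcess
open SimpleGraph Matrix Polynomial

/-- An equality of image multisets is lifted to an indexing of the eigenvalues themselves, one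
preimage for each equation. -/
lemma exists_eq_map_of_map_eq {α β ι : Type*} [DecidableEq ι] [Inhabited α] {f : α → β} {θ : ι → β}
    (s : Finset ι) (N : Multiset α) (h : N.map f = s.val.map θ) :
    ∃ μ : ι → α, N = s.val.map μ ∧ ∀ p ∈ s, f (μ p) = θ p := by
  classical
  induction s using Finset.induction_on generalizing N with
  | empty => exact ⟨fun _ => default, by simpa using h, by simp⟩
  | insert a s ha ih =>
    rw [Finset.insert_val_of_notMem ha, Multiset.map_cons] at h
    obtain ⟨x, hx, hfx, hr⟩ := (Multiset.map_eq_cons f _ _ _).2 h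
    obtain ⟨μ, hμ, hf⟩ := ih _ hr
    have hne : ∀ p ∈ s, p ≠ a := fun p hp he => ha (he ▸ hp)
    refine ⟨Function.update μ a x, ?_, ?_⟩
    · rw [Finset.insert_val_of_notMem ha, Multiset.map_cons, Function.update_self,
        Multiset.map_congr rfl (fun p hp => Function.update_of_ne (hne p hp) x μ), ← hμ,
        Multiset.cons_erase hx]
    · intro p hp
      rcases Finset.mem_insert.1 hp with rfl | hp
      · rw [Function.update_self, hfx]
      · rw [Function.update_of_ne (hne p hp), hf p hp]

lemma exists_eq_add_map_of_map_eq {α β ι : Type*} [DecidableEq ι] [Inhabited α] {f : α → β}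
    {θ : ι → β} {b : β} (s : Finset ι) (m : ℕ) (N : Multiset α)
    (h : N.map f = Multiset.replicate m b + s.val.map θ) :
    ∃ (S : Multiset α) (μ : ι → α), S.card = m ∧ (∀ x ∈ S, f x = b) ∧
      (∀ p ∈ s, f (μ p) = θ p) ∧ N = S + s.val.map μ := by
  classical
  induction m generalizing N with
  | zero =>
    obtain ⟨μ, h1, h2⟩ := exists_eq_map_of_map_eq s N (by simpa using h)
    exact ⟨0, μ, by simp, by simp, h2, by simpa using h1⟩
  | succ m ih =>
    rw [Multiset.replicate_succ, Multiset.cons_add] at h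
    obtain ⟨x, hx, hfx, hr⟩ := (Multiset.map_eq_cons f _ _ _).2 h
    obtain ⟨S, μ, h1, h2, h3, h4⟩ := ih _ hr
    refine ⟨x ::ₘ S, μ, by simp [h1], ?_, h3, ?_⟩
    · intro y hy
      rcases Multiset.mem_cons.1 hy with rfl | hy
      · exact hfx
      · exact h2 y hy
    · rw [Multiset.cons_add, ← h4, Multiset.cons_erase hx]

section Angles
variable {c : ℕ} {l : Fin c → ℕ} {p : Σ _ : Fin c, ℕ}

lemma mem_cycleIndices : p ∈ cycleIndices l ↔ 1 ≤ p.2 ∧ p.2 ≤ l p.1 - 1 := by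
  simp [cycleIndices]

lemma angle_bounds (hp : p ∈ cycleIndices l) : 0 < 2 * Real.pi * (p.2 : ℝ) / (l p.1 : ℝ) ∧
    2 * Real.pi * (p.2 : ℝ) / (l p.1 : ℝ) < 2 * Real.pi := by
  obtain ⟨h1, h2⟩ := mem_cycleIndices.1 hp
  have h3 : (0 : ℝ) < p.2 := by exact_mod_cast h1
  have h4 : (p.2 : ℝ) < l p.1 := by exact_mod_cast (by omega)
  have h5 : (0 : ℝ) < l p.1 := h3.trans h4
  have := Real.pi_pos
  refine ⟨by positivity, ?_⟩
  rw [div_lt_iff₀ h5]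
  exact mul_lt_mul_of_pos_left h4 (by positivity)

lemma cos_angle_ne_one (hp : p ∈ cycleIndices l) :
    Real.cos (2 * Real.pi * (p.2 : ℝ) / (l p.1 : ℝ)) ≠ 1 := by
  obtain ⟨h1, h2⟩ := angle_bounds hp
  intro h
  exact h1.ne' ((Real.cos_eq_one_iff_of_lt_of_lt (by linarith [Real.pi_pos]) h2).1 h)

lemma two_mul_eq_of_cos_angle_eq (hp : p ∈ cycleIndices l)
    (h : Real.cos (2 * Real.pi * (p.2 : ℝ) / (l p.1 : ℝ)) = -1) : 2 * p.2 = l p.1 := by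
  obtain ⟨h1, h2⟩ := angle_bounds hp
  obtain ⟨h3, h4⟩ := mem_cycleIndices.1 hp
  have hpi := Real.pi_pos
  have h5 : Real.cos (2 * Real.pi * (p.2 : ℝ) / (l p.1 : ℝ) - Real.pi) = 1 := by
    rw [Real.cos_sub_pi, h, neg_neg]
  have h6 := (Real.cos_eq_one_iff_of_lt_of_lt (by linarith) (by linarith)).1 h5
  have h7 : (l p.1 : ℝ) ≠ 0 := by exact_mod_cast (by omega)
  have h8 : Real.pi * (2 * p.2 - l p.1) = 0 := by
    field_simp at h6
    linear_combination h6
  have h9 : (2 * p.2 : ℝ) = l p.1 := by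
    have := (mul_eq_zero.1 h8).resolve_left hpi.ne'
    linarith
  exact_mod_cast h9

end Angles

lemma mem_roots_charpoly_of_mulVec {n : Type*} [Fintype n] [DecidableEq n] {A : Matrix n n ℝ}
    {v : n → ℝ} {t : ℝ} (hv : v ≠ 0) (h : A *ᵥ v = t • v) : t ∈ A.charpoly.roots := by
  rw [mem_roots (charpoly_monic A).ne_zero, IsRoot, eval_charpoly]
  refine exists_mulVec_eq_zero_iff.1 ⟨v, hv, ?_⟩
  rw [sub_mulVec, h]
  simp [Matrix.diagonal_const_mulVec]

lemma isBipartiteWith_mem_iff {V : Type*} {G : SimpleGraph V} {V₁ V₂ : Set V}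
    (hb : G.IsBipartiteWith V₁ V₂) (hun : V₁ ∪ V₂ = Set.univ) {m : ℕ} {u v : V}
    (h : HasWalk G m u v) : (u ∈ V₁ ↔ v ∈ V₁) ↔ Even m := by
  induction m generalizing v with
  | zero => simp [hasWalk_zero.1 h]
  | succ m ih =>
    obtain ⟨x, hx, hux⟩ := hasWalk_succ.1 h
    have h1 := ih hux
    have h2 : x ∈ V₁ ↔ v ∉ V₁ := by
      have hd : ∀ y, y ∈ V₁ → y ∉ V₂ := fun y h1 h2 => Set.disjoint_left.1 hb.disjoint h1 h2
      have hu : v ∈ V₁ ∨ v ∈ V₂ := by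
        have : v ∈ V₁ ∪ V₂ := hun ▸ Set.mem_univ v
        exact this
      rcases hb.mem_of_adj hx with ⟨h3, h4⟩ | ⟨h3, h4⟩
      · exact ⟨fun _ h5 => hd _ h5 h4, fun _ => h3⟩
      · exact ⟨fun h5 => absurd h3 (hd _ h5), fun h5 => absurd h4 h5⟩
    rw [Nat.even_add_one]
    tauto

lemma cycleUnion_invariant {W : Type*} {c : ℕ} {l : Fin c → ℕ} {E : SimpleGraph W}
    (e : cycleUnion l ≃g E) {P : W → Prop} (hP : ∀ u v, E.Adj u v → (P u ↔ P v)) (i : Fin c)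
    (x y : Fin (l i)) : P (e ⟨i, x⟩) ↔ P (e ⟨i, y⟩) := by
  obtain ⟨q⟩ := cycleGraph_preconnected x y
  induction q with
  | nil => rfl
  | cons hadj _ ih => exact (hP _ _ (e.map_rel_iff.2 ⟨i, _, _, rfl, rfl, hadj⟩)).trans ih

namespace HasExcessFour
variable {V : Type*} [Fintype V] [DecidableEq V] {G : SimpleGraph V} [DecidableRel G.Adj]
  {k d : ℕ} (h : HasExcessFour G k d)
include h

lemma three_le_eval_H : 3 ≤ (H k (d - 1)).eval (k : ℝ) := by
  rw [h.eval_H_eq]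
  have hk := h.six_le
  have h1 : d ≤ ∑ i ∈ Finset.range d, (k - 1) ^ i := by
    calc d = ∑ i ∈ Finset.range d, 1 := by simp
      _ ≤ _ := Finset.sum_le_sum fun i _ => Nat.one_le_pow _ _ (by omega)
  exact_mod_cast h.three_le.trans h1

/-- The spectra of `A` and of `E` determine each other away from the trivial eigenvalues. -/
lemma exists_spectrum : ∃ N : Multiset ℝ,
    spectrumOf (G.adjMatrix ℝ) = {(k : ℝ), -(k : ℝ)} + N ∧
    spectrumOf (excessMatrix G d) =
      {2, 2 * (-1) ^ (d - 1)} + N.map fun x => -(H k (d - 1)).eval x := by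
  obtain ⟨s, hs⟩ := h.exists_sign
  have hne : Nonempty V := h.connected.nonempty
  have hk : (6 : ℝ) ≤ k := by exact_mod_cast h.six_le
  have hA1 := adjMatrix_mulVec_one h.regular
  have hAs := h.adjMatrix_mulVec_sign hs
  have hs0 : s ≠ 0 := by
    intro h0
    have := h.sign_mul_self hs hne.some
    simp [h0] at this
  have r1 : (k : ℝ) ∈ spectrumOf (G.adjMatrix ℝ) :=
    mem_roots_charpoly_of_mulVec (fun h0 => by simpa using congrFun h0 hne.some) hA1
  have r2 : -(k : ℝ) ∈ spectrumOf (G.adjMatrix ℝ) := mem_roots_charpoly_of_mulVec hs0 hAs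
  obtain ⟨N₁, hN₁⟩ := Multiset.exists_cons_of_mem r1
  rw [hN₁, Multiset.mem_cons] at r2
  obtain ⟨N, hN⟩ := Multiset.exists_cons_of_mem (r2.resolve_left (by linarith))
  have hspec : spectrumOf (G.adjMatrix ℝ) = {(k : ℝ), -(k : ℝ)} + N := by
    rw [hN₁, hN]
    simp
  refine ⟨N, hspec, ?_⟩
  set P := -H k (d - 1) with hP
  have hM0 : -aeval (G.adjMatrix ℝ) (H k (d - 1)) = aeval (G.adjMatrix ℝ) P := by
    rw [hP, map_neg]
  have hE := h.excessMatrix_eq hs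
  rw [hM0] at hE
  have hroots : (aeval (G.adjMatrix ℝ) P).charpoly.roots =
      (spectrumOf (G.adjMatrix ℝ)).map fun x => P.eval x :=
    charpoly_aeval_roots (by
      rw [Matrix.IsHermitian, conjTranspose_eq_transpose_of_trivial, transpose_adjMatrix]) P
  have v1 := aeval_mulVec_of_mulVec_eq_smul hA1 P
  have b1 := charpoly_add_vecMulVec (fun _ => (1 / 2 : ℝ)) v1
  have v2 : (aeval (G.adjMatrix ℝ) P + vecMulVec (fun _ => 1) (fun _ => 1 / 2)) *ᵥ s =
      P.eval (-(k : ℝ)) • s := by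
    have h3 : (fun _ => (1 / 2 : ℝ)) ⬝ᵥ s = 0 := by
      simp [dotProduct, ← Finset.mul_sum, h.sum_sign hs]
    rw [add_mulVec, aeval_mulVec_of_mulVec_eq_smul hAs, vecMulVec_mulVec, h3]
    simp
  have b2 := charpoly_add_vecMulVec ((((-1) ^ (d - 1) / 2 : ℝ)) • s) v2
  rw [← hE] at b2
  have hn := h.card_div_two
  have e1 : P.eval (k : ℝ) + (fun _ : V => (1 : ℝ)) ⬝ᵥ (fun _ => (1 / 2 : ℝ)) = 2 := by
    have : (fun _ : V => (1 : ℝ)) ⬝ᵥ (fun _ => (1 / 2 : ℝ)) = (Fintype.card V : ℝ) / 2 := by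
      simp [dotProduct]
      ring
    rw [this, hn, hP, eval_neg]
    ring
  have e2 : P.eval (-(k : ℝ)) + s ⬝ᵥ (((-1) ^ (d - 1) / 2 : ℝ) • s) = 2 * (-1) ^ (d - 1) := by
    have : s ⬝ᵥ s = Fintype.card V := by
      simp [dotProduct, h.sign_mul_self hs]
    rw [dotProduct_smul, this, hP, eval_neg, eval_H_neg, smul_eq_mul]
    linear_combination (-1) ^ (d - 1) * hn
  rw [e1] at b1
  rw [e2] at b2
  have m : ∀ M : Matrix V V ℝ, M.charpoly ≠ 0 := fun M => (charpoly_monic M).ne_zero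
  have b1' := congrArg roots b1
  have b2' := congrArg roots b2
  rw [roots_mul (mul_ne_zero (m _) (X_sub_C_ne_zero _)),
    roots_mul (mul_ne_zero (m _) (X_sub_C_ne_zero _)), roots_X_sub_C, roots_X_sub_C] at b1' b2'
  rw [hroots, hspec, Multiset.map_add] at b1'
  have e3 : (({(k : ℝ), -(k : ℝ)} : Multiset ℝ).map fun x => P.eval x) =
      {P.eval (k : ℝ)} + {P.eval (-(k : ℝ))} := by simp
  rw [e3] at b1'
  have e4 : (N.map fun x => -(H k (d - 1)).eval x) = N.map fun x => P.eval x := by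
    simp [hP]
  rw [e4]
  change (excessMatrix G d).charpoly.roots = _
  have e5 : ({2, 2 * (-1) ^ (d - 1)} : Multiset ℝ) = {2} + {2 * (-1) ^ (d - 1)} := rfl
  rw [e5]
  generalize (excessMatrix G d).charpoly.roots = RE at *
  generalize (aeval (G.adjMatrix ℝ) P + vecMulVec (fun _ => 1) (fun _ => 1 / 2)).charpoly.roots
    = R1 at *
  generalize ({P.eval (k : ℝ)} : Multiset ℝ) = a at *
  generalize ({P.eval (-(k : ℝ))} : Multiset ℝ) = b at *
  generalize (N.map fun x => P.eval x) = T at *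
  generalize ({2} : Multiset ℝ) = t at *
  generalize ({2 * (-1) ^ (d - 1)} : Multiset ℝ) = t' at *
  -- Brauer's theorem, applied along the all-ones vector and then along s, exchanges a for t and b
  -- for t'; the second step needs s to be orthogonal to the all-ones vector.
  have : (a + b) + RE = (a + b) + (t + t' + T) := by
    calc (a + b) + RE = a + (RE + b) := by abel
      _ = (R1 + a) + t' := by rw [b2']; abel
      _ = _ := by rw [b1']; abel
  exact add_left_cancel this

/-- The eigenvalues k and -k never count, since H_{d-1} has absolute value at least 3 there. -/
lemma card_filter_eval_H {S T : Multiset ℝ} (hS : ∀ x ∈ S, (H k (d - 1)).eval x = -2)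
    (hT : ∀ x ∈ T, (H k (d - 1)).eval x ≠ -2) :
    (({(k : ℝ), -(k : ℝ)} + S + T).filter fun x => (H k (d - 1)).eval x = -2).card = S.card := by
  have h1 := h.three_le_eval_H
  have h2 : (H k (d - 1)).eval (-(k : ℝ)) ≠ -2 := by
    rw [eval_H_neg]
    rcases neg_one_pow_eq_or ℝ (d - 1) with h3 | h3 <;> rw [h3] <;> intro h4 <;> linarith
  have h3 : ({(k : ℝ), -(k : ℝ)} : Multiset ℝ).filter (fun x => (H k (d - 1)).eval x = -2) = 0 := by
    rw [Multiset.filter_eq_nil]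
    intro x hx
    simp only [Multiset.insert_eq_cons, Multiset.mem_cons, Multiset.mem_singleton] at hx
    rcases hx with rfl | rfl
    · intro h4
      linarith
    · exact h2
  rw [Multiset.filter_add, Multiset.filter_add, h3, Multiset.filter_eq_self.2 hS,
    Multiset.filter_eq_nil.2 hT]
  simp

end HasExcessFour

lemma hasExcessFour_of_isKGGraph {V : Type*} [Fintype V] {G : SimpleGraph V}
    [DecidableRel G.Adj] {k g d : ℕ} (hk : 6 ≤ k) (hg : 6 ≤ g) (hgd : g = 2 * d)
    (hG : IsKGGraph G k g) (hexc : excess V k g = 4) : HasExcessFour G k d where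
  regular := hG.regular
  six_le := hk
  three_le := by omega
  le_egirth := by rw [hG.girth_eq, hgd]
  card_eq := by
    have h1 : ¬ Odd g := by rw [hgd]; simp
    rw [excess, mooreBound, if_neg h1, show (g - 2) / 2 + 1 = d by omega] at hexc
    omega

namespace HasExcessFour
variable {V : Type*} [Fintype V] [DecidableEq V] {G : SimpleGraph V} [DecidableRel G.Adj]
  {k d : ℕ} (h : HasExcessFour G k d) {c : ℕ} {l : Fin c → ℕ}
include h

lemma ncard_neighborSet_excessGraph (u : V) : ((excessGraph G d).neighborSet u).ncard = 2 := by
  rw [← h.degree_excessGraph u, ← card_neighborSet_eq_degree, Set.ncard_eq_toFinset_card',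
    Set.toFinset_card]

lemma cycle_subset_of_odd (ho : Odd d) (e : cycleUnion l ≃g excessGraph G d) {V₁ V₂ : Set V}
    (hb : G.IsBipartiteWith V₁ V₂) (hun : V₁ ∪ V₂ = Set.univ) (i : Fin c) :
    (∀ x : Fin (l i), e ⟨i, x⟩ ∈ V₁) ∨ (∀ x : Fin (l i), e ⟨i, x⟩ ∈ V₂) := by
  have hP : ∀ u v, (excessGraph G d).Adj u v → (u ∈ V₁ ↔ v ∈ V₁) := by
    intro u v huv
    rw [isBipartiteWith_mem_iff hb hun (h.hasWalk_dist u v)]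
    rw [show G.dist u v = d + 1 from huv]
    exact ho.add_one
  by_cases hx : ∃ x : Fin (l i), e ⟨i, x⟩ ∈ V₁
  · obtain ⟨x, hx⟩ := hx
    exact Or.inl fun y => (cycleUnion_invariant e hP i x y).1 hx
  · right
    intro y
    have : e ⟨i, y⟩ ∈ V₁ ∪ V₂ := hun ▸ Set.mem_univ _
    exact this.resolve_left fun hy => hx ⟨y, hy⟩

lemma exists_spectrum_of_iso (hl : ∀ i, 3 ≤ l i) (e : cycleUnion l ≃g excessGraph G d) :
    ∃ N : Multiset ℝ, spectrumOf (G.adjMatrix ℝ) = {(k : ℝ), -(k : ℝ)} + N ∧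
      ({2, 2 * (-1) ^ (d - 1)} : Multiset ℝ) + N.map (fun x => -(H k (d - 1)).eval x) =
        Multiset.replicate c 2 +
          (cycleIndices l).val.map (fun p => 2 * Real.cos (2 * Real.pi * p.2 / l p.1)) := by
  classical
  obtain ⟨N, h1, h2⟩ := h.exists_spectrum
  refine ⟨N, h1, ?_⟩
  rw [← h2, ← spectrumOf_adjMatrix_cycleUnion hl, excessMatrix_eq_adjMatrix,
    ← Iso.reindex_adjMatrix ℝ e, spectrumOf, charpoly_reindex, spectrumOf]

theorem spectrum_of_odd (ho : Odd d) (hl : ∀ i, 3 ≤ l i) (e : cycleUnion l ≃g excessGraph G d) :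
    ∃ (S : Multiset ℝ) (μ : (Σ _ : Fin c, ℕ) → ℝ), S.card + 2 = c ∧
      (∀ x ∈ S, (H k (d - 1)).eval x = -2) ∧
      (∀ p ∈ cycleIndices l, (H k (d - 1)).eval (μ p) =
        -2 * Real.cos (2 * Real.pi * (p.2 : ℝ) / (l p.1 : ℝ))) ∧
      spectrumOf (G.adjMatrix ℝ) =
        {(k : ℝ), -(k : ℝ)} + S + (cycleIndices l).val.map μ := by
  obtain ⟨N, h1, h2⟩ := h.exists_spectrum_of_iso hl e
  have hev : Even (d - 1) := by
    obtain ⟨a, ha⟩ := ho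
    exact ⟨a, by omega⟩
  rw [hev.neg_one_pow, mul_one] at h2
  -- The left side contains 2 twice, and no cosine with 1 ≤ j ≤ l_i - 1 equals 1, so each copy comes
  -- from a cycle.
  have hc : 2 ≤ c := by
    have h3 := congrArg (Multiset.count (2 : ℝ)) h2
    have h4 : Multiset.count (2 : ℝ) ((cycleIndices l).val.map
        (fun p => 2 * Real.cos (2 * Real.pi * p.2 / l p.1))) = 0 := by
      rw [Multiset.count_eq_zero, Multiset.mem_map]
      rintro ⟨p, hp, h5⟩
      exact cos_angle_ne_one hp (by linarith)
    rw [Multiset.count_add, Multiset.count_add, h4, Multiset.count_replicate_self] at h3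
    simp at h3
    omega
  have hrep : Multiset.replicate c (2 : ℝ) = {2, 2} + Multiset.replicate (c - 2) 2 := by
    conv_lhs => rw [← Nat.add_sub_cancel' hc, Multiset.replicate_add]
    rfl
  rw [hrep, add_assoc] at h2
  obtain ⟨S, μ, hS, hS2, hμ, hN⟩ := exists_eq_add_map_of_map_eq _ _ _ (add_left_cancel h2)
  refine ⟨S, μ, by omega, fun x hx => ?_, fun p hp => ?_, by rw [h1, hN, add_assoc]⟩
  · linarith [hS2 x hx]
  · linarith [hμ p hp]

theorem spectrum_of_even (he : Even d) (hl : ∀ i, 3 ≤ l i) (e : cycleUnion l ≃g excessGraph G d) :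
    ∃ (S : Multiset ℝ) (μ : (Σ _ : Fin c, ℕ) → ℝ) (p₀ : Σ _ : Fin c, ℕ), S.card + 1 = c ∧
      (∀ x ∈ S, (H k (d - 1)).eval x = -2) ∧ p₀ ∈ cycleIndices l ∧ 2 * p₀.2 = l p₀.1 ∧
      (∀ p ∈ (cycleIndices l).erase p₀, (H k (d - 1)).eval (μ p) =
        -2 * Real.cos (2 * Real.pi * (p.2 : ℝ) / (l p.1 : ℝ))) ∧
      spectrumOf (G.adjMatrix ℝ) =
        {(k : ℝ), -(k : ℝ)} + S + ((cycleIndices l).erase p₀).val.map μ := by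
  obtain ⟨N, h1, h2⟩ := h.exists_spectrum_of_iso hl e
  have hod : Odd (d - 1) := by
    have := h.three_le
    obtain ⟨a, ha⟩ := he
    exact ⟨a - 1, by omega⟩
  rw [hod.neg_one_pow] at h2
  -- For even d the moved eigenvalue is -2, so some cosine must be -1; its index is the omitted
  -- pair.
  have h3 : (2 * -1 : ℝ) ∈ (cycleIndices l).val.map
      (fun p => 2 * Real.cos (2 * Real.pi * p.2 / l p.1)) := by
    have : (2 * -1 : ℝ) ∈ Multiset.replicate c (2 : ℝ) + (cycleIndices l).val.map
        (fun p => 2 * Real.cos (2 * Real.pi * p.2 / l p.1)) := by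
      rw [← h2]
      simp
    refine (Multiset.mem_add.1 this).resolve_left fun h4 => ?_
    have := Multiset.eq_of_mem_replicate h4
    norm_num at this
  obtain ⟨p₀, hp₀, h4⟩ := Multiset.mem_map.1 h3
  have hc : 1 ≤ c := p₀.1.pos
  have h5 : (cycleIndices l).val = p₀ ::ₘ ((cycleIndices l).erase p₀).val := by
    rw [Finset.erase_val, Multiset.cons_erase hp₀]
  rw [h5, Multiset.map_cons, h4] at h2
  have h6 : N.map (fun x => -(H k (d - 1)).eval x) = Multiset.replicate (c - 1) 2 +
      ((cycleIndices l).erase p₀).val.map (fun p => 2 * Real.cos (2 * Real.pi * p.2 / l p.1)) := by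
    apply add_left_cancel (a := ({2, 2 * -1} : Multiset ℝ))
    rw [h2]
    have hrep : Multiset.replicate c (2 : ℝ) = 2 ::ₘ Multiset.replicate (c - 1) 2 := by
      conv_lhs => rw [← Nat.sub_add_cancel hc, Multiset.replicate_succ]
    rw [hrep]
    simp only [Multiset.insert_eq_cons, Multiset.cons_add, Multiset.singleton_add,
      Multiset.add_cons]
    exact Multiset.cons_swap _ _ _
  obtain ⟨S, μ, hS, hS2, hμ, hN⟩ := exists_eq_add_map_of_map_eq _ _ _ h6
  refine ⟨S, μ, p₀, by omega, fun x hx => ?_, hp₀, two_mul_eq_of_cos_angle_eq hp₀ (by linarith),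
    fun p hp => ?_, by rw [h1, hN, add_assoc]⟩
  · linarith [hS2 x hx]
  · linarith [hμ p hp]

end HasExcessFour

end BipartiteExcess

theorem mainTheorem3 {V : Type*} [Fintype V] [DecidableEq V] (G : SimpleGraph V)
    [DecidableRel G.Adj] (k g d : ℕ) (hk : 6 ≤ k) (hg : 6 ≤ g) (hgd : g = 2 * d)
    (hG : BipartiteExcess.IsKGGraph G k g) (hexc : BipartiteExcess.excess V k g = 4) :
    G.IsBipartite ∧
    BipartiteExcess.excessMatrix G d = (BipartiteExcess.excessGraph G d).adjMatrix ℝ ∧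
    ∃ (c : ℕ) (l : Fin c → ℕ)
      (e : BipartiteExcess.cycleUnion l ≃g BipartiteExcess.excessGraph G d),
      (∀ i, 3 ≤ l i) ∧
      (Odd d → ∀ V₁ V₂ : Set V, G.IsBipartiteWith V₁ V₂ → V₁ ∪ V₂ = Set.univ →
        ∀ i, (∀ x : Fin (l i), e ⟨i, x⟩ ∈ V₁) ∨ (∀ x : Fin (l i), e ⟨i, x⟩ ∈ V₂)) ∧
      (Odd d → ∃ (S : Multiset ℝ) (μ : (Σ _ : Fin c, ℕ) → ℝ),
        S.card + 2 = c ∧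
        (∀ x ∈ S, (BipartiteExcess.H k (d - 1)).eval x = -2) ∧
        (∀ p ∈ BipartiteExcess.cycleIndices l, (BipartiteExcess.H k (d - 1)).eval (μ p) =
          -2 * Real.cos (2 * Real.pi * (p.2 : ℝ) / (l p.1 : ℝ))) ∧
        BipartiteExcess.spectrumOf (G.adjMatrix ℝ) =
          {(k : ℝ), -(k : ℝ)} + S + (BipartiteExcess.cycleIndices l).val.map μ) ∧
      (Even d → ∃ (S : Multiset ℝ) (μ : (Σ _ : Fin c, ℕ) → ℝ)
          (p₀ : Σ _ : Fin c, ℕ),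
        S.card + 1 = c ∧
        (∀ x ∈ S, (BipartiteExcess.H k (d - 1)).eval x = -2) ∧
        p₀ ∈ BipartiteExcess.cycleIndices l ∧ 2 * p₀.2 = l p₀.1 ∧
        (∀ p ∈ (BipartiteExcess.cycleIndices l).erase p₀,
          (BipartiteExcess.H k (d - 1)).eval (μ p) =
            -2 * Real.cos (2 * Real.pi * (p.2 : ℝ) / (l p.1 : ℝ))) ∧
        BipartiteExcess.spectrumOf (G.adjMatrix ℝ) =
          {(k : ℝ), -(k : ℝ)} + S + ((BipartiteExcess.cycleIndices l).erase p₀).val.map μ) ∧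
      (Odd d → ((BipartiteExcess.spectrumOf (G.adjMatrix ℝ)).filter
        fun x => (BipartiteExcess.H k (d - 1)).eval x = -2).card + 2 = c) ∧
      (Even d → ((BipartiteExcess.spectrumOf (G.adjMatrix ℝ)).filter
        fun x => (BipartiteExcess.H k (d - 1)).eval x = -2).card + 1 = c) := by
  have h := BipartiteExcess.hasExcessFour_of_isKGGraph hk hg hgd hG hexc
  obtain ⟨c, l, e, hl⟩ := BipartiteExcess.exists_iso_cycleUnion
    (G := BipartiteExcess.excessGraph G d) h.ncard_neighborSet_excessGraph
  have hodd := fun ho : Odd d => h.spectrum_of_odd ho hl e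
  have heven := fun he : Even d => h.spectrum_of_even he hl e
  refine ⟨h.isBipartite, BipartiteExcess.excessMatrix_eq_adjMatrix G d, c, l, e, hl,
    fun ho V₁ V₂ hb hun => h.cycle_subset_of_odd ho e hb hun, hodd, heven, fun ho => ?_,
    fun he => ?_⟩
  · obtain ⟨S, μ, h1, h2, h3, h4⟩ := hodd ho
    rw [h4, h.card_filter_eval_H h2, h1]
    intro x hx
    obtain ⟨p, hp, rfl⟩ := Multiset.mem_map.1 hx
    rw [h3 p hp]
    intro h5
    exact BipartiteExcess.cos_angle_ne_one hp (by linarith)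
  · obtain ⟨S, μ, p₀, h1, h2, -, -, h3, h4⟩ := heven he
    rw [h4, h.card_filter_eval_H h2, h1]
    intro x hx
    obtain ⟨p, hp, rfl⟩ := Multiset.mem_map.1 hx
    rw [h3 p hp]
    intro h5
    exact BipartiteExcess.cos_angle_ne_one (Finset.mem_of_mem_erase hp) (by linarith)
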